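/- Let $\mathbb{K}$ be a commutative ring. \textbf{Braid groups.} Let $\mathbf{B}_n$ be the braid group on $n$ strands, with Artin generators $\sigma_1,\dots,\sigma_{n-1}$, and $\mathbf{F}_n=\langle g_1,\dots,g_n\rangle$ the free group of rank $n$. For $f\in\mathbf{B}_n$ and $g\in\mathbf{B}_m$ let $f\natural g\in\mathbf{B}_{n+m}$ be their juxtaposition ($f$ on the first $n$ strands, $g$ on the last $m$), let $id_n$ be the unit of $\mathbf{B}_n$, and let $$b_{n,m}=(\sigma_m\circ\cdots\circ\sigma_1)\circ(\sigma_{m+1}\circ\cdots\circ\sigma_2)\circ\cdots\circ(\sigma_{n+m-1}\circ\cdots\circ\sigma_n)\in\mathbf{B}_{n+m}$$ be the braiding. \textbf{The category $\mathfrak{U}\boldsymbol{\beta}$.} Its objects are the natural numbers. There are morphisms $n\to n'$ only if $n\le n'$; they are then the classes $[n'-n,f]$ of elements $f\in\mathbf{B}_{n'}$ modulo $f\sim f\circ(g\natural id_n)$, $g\in\mathbf{B}_{n'-n}$. Composition is $[n''-n',f']\circ[n'-n,f]=[n''-n,f'\circ(id_{n''-n'}\natural f)]$, and a braid $f \in \mathbf{B}_n$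 is viewed as the automorphism $[0,f]$ of $n$. For $x\in\mathbb{N}$ the functor $x\natural-$ is given on objects by $n\mapsto x+n$ and on morphisms by $id_x\natural[n'-n,f]=[n'-n,(id_x\natural f)\circ(b_{x,n'-n}^{-1}\natural id_n)]$. \textbf{Strong polynomial functors.} Let $\mathbf{Fct}(\mathfrak{U}\boldsymbol{\beta},\mathbb{K}\text{-}\mathfrak{Mod})$ be the category of functors from $\mathfrak{U}\boldsymbol{\beta}$ to $\mathbb{K}$-modules. For $x\in\mathbb{N}$ let $\tau_x(F)=F(x\natural-)$, let $i_x(F):F\to\tau_x(F)$ be the natural transformation given by $F([x,id_{x+n}]):F(n)\to F(x+n)$, and let $\delta_x(F)=\operatorname{coker}(i_x(F))$. The full subcategories $\mathcal{P}ol_d^{strong}(\mathfrak{U}\boldsymbol{\beta},\mathbb{K}\text{-}\mathfrak{Mod})$ are defined recursively: for $d<0$ the objects are the zero functors, and for $d\ge0$ an object is a functor $F$ such that $\delta_x(F)\in\mathcal{P}ol_{d-1}^{strong}$ for all $x\in\mathbb{N}$. The strong degree of a strong polynomial functor $F$ is the smallest $d\in\mathbb{N}$ such that $F\in\mathcal{P}ol_d^{strong}$.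 \textbf{Coherent reliable families.} Fix families of group homomorphisms $a_n:\mathbf{B}_n\to Aut(\mathbf{F}_n)$ and $\varsigma_n:\mathbf{F}_n\to\mathbf{B}_{n+1}$, $n\in\mathbb{N}$. For $n\le n'$, let $\iota*id_{\mathbf{F}_n}:\mathbf{F}_n\to\mathbf{F}_{n'}$, $g_i\mapsto g_{n'-n+i}$, and $id_{\mathbf{F}_n}*\iota:\mathbf{F}_n\to\mathbf{F}_{n'}$, $g_i\mapsto g_i$. Assume that the families are coherent, that is, for all $n\le n'$: \begin{itemize} \item $(id_1\natural[n'-n,id_{n'}])\circ\varsigma_n(g)=\varsigma_{n'}((\iota*id_{\mathbf{F}_n})(g))\circ(id_1\natural[n'-n,id_{n'}])$ in $\mathfrak{U}\boldsymbol{\beta}$, for all $g\in\mathbf{F}_n$; \item $(\iota*id_{\mathbf{F}_n})\circ a_n(\sigma)=a_{n'}(\sigma'\natural\sigma)\circ(\iota*id_{\mathbf{F}_n})$ for all $\sigma\in\mathbf{B}_n$, $\sigma'\in\mathbf{B}_{n'-n}$; \item $(id_1\natural\sigma)\circ\varsigma_n(g)=\varsigma_n(a_n(\sigma)(g))\circ(id_1\natural\sigma)$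 in $\mathbf{B}_{n+1}$ for all $\sigma\in\mathbf{B}_n$, $g\in\mathbf{F}_n$; \end{itemize} and reliable, that is, moreover, for all $n\le n'$: \begin{itemize} \item $a_{1+n'}(b_{1,n'-n}^{-1}\natural id_n)\circ(\iota*id_{\mathbf{F}_{1+n}})\circ(id_{\mathbf{F}_1}*\iota)=id_{\mathbf{F}_1}*\iota$ as homomorphisms $\mathbf{F}_1\to\mathbf{F}_{1+n'}$; \item $a_{n'}(id_{n'-n}\natural\sigma)\circ(id_{\mathbf{F}_{n'-n}}*\iota)=id_{\mathbf{F}_{n'-n}}*\iota$ as homomorphisms $\mathbf{F}_{n'-n}\to\mathbf{F}_{n'}$, for all $\sigma\in\mathbf{B}_n$. \end{itemize} \textbf{The Long-Moody functor.} Let $\mathcal{I}_{\mathbb{K}[\mathbf{F}_n]}$ be the augmentation ideal of the group algebra. The endofunctor $\mathbf{LM}$ of $\mathbf{Fct}(\mathfrak{U}\boldsymbol{\beta},\mathbb{K}\text{-}\mathfrak{Mod})$ associated with the two families is given by $\mathbf{LM}(F)(n)=\mathcal{I}_{\mathbb{K}[\mathbf{F}_n]}\otimes_{\mathbb{K}[\mathbf{F}_n]}F(1+n)$,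 where $\mathbf{F}_n$ acts on $F(1+n)$ through $\varsigma_n$, by $$\mathbf{LM}(F)([n'-n,\sigma])(i\otimes v)=a_{n'}(\sigma)\big((\iota*id_{\mathbf{F}_n})(i)\big)\otimes F(id_1\natural[n'-n,\sigma])(v),$$ and by $\mathbf{LM}(\eta)_n=id\otimes\eta_{1+n}$ for a natural transformation $\eta$. \textbf{Statement.} Let $d\in\mathbb{N}$. If $F$ is an object of $\mathcal{P}ol_d^{strong}(\mathfrak{U}\boldsymbol{\beta},\mathbb{K}\text{-}\mathfrak{Mod})$ (in particular, if $F$ is strong polynomial of degree $d$), then \begin{enumerate} \item $\tau_2(F)$ is an object of $\mathcal{P}ol_d^{strong}(\mathfrak{U}\boldsymbol{\beta},\mathbb{K}\text{-}\mathfrak{Mod})$; \item $\mathbf{LM}(F)$ is an object of $\mathcal{P}ol_{d+1}^{strong}(\mathfrak{U}\boldsymbol{\beta},\mathbb{K}\text{-}\mathfrak{Mod})$. \end{enumerate} Hence the endofunctor $\mathbf{LM}$ restricts to a functor $\mathcal{P}ol_d^{strong}(\mathfrak{U}\boldsymbol{\beta},\mathbb{K}\text{-}\mathfrak{Mod})\to\mathcal{P}ol_{d+1}^{strong}(\mathfrak{U}\boldsymbol{\beta},\mathbb{K}\text{-}\mathfrak{Mod})$.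 -/

import Mathlib

open CategoryTheory CategoryTheory.Limits
open scoped TensorProduct

universe u

namespace LongMoody

/-! ### Braid groups -/

/-- Artin's relations for the braid group on `n` strands. The generator `σ_{i+1}` of the usual
numbering `σ_1, …, σ_{n-1}` is the letter `i : Fin (n - 1)`; there is none for `n = 0, 1`. -/
def braidRels (n : ℕ) : Set (FreeGroup (Fin (n - 1))) :=
  {r | ∃ i j : Fin (n - 1), (i : ℕ) + 1 = j ∧
      r = FreeGroup.of i * FreeGroup.of j * FreeGroup.of i *
        (FreeGroup.of j * FreeGroup.of i * FreeGroup.of j)⁻¹} ∪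
  {r | ∃ i j : Fin (n - 1), (i : ℕ) + 2 ≤ j ∧
      r = FreeGroup.of i * FreeGroup.of j * (FreeGroup.of j * FreeGroup.of i)⁻¹}

/-- The braid group `B_n`. -/
abbrev Braid (n : ℕ) : Type := PresentedGroup (braidRels n)

/-- The Artin generator `σ_{i+1}` of `B_n` when `i + 1 < n`, and `1` otherwise. -/
def sigma (n i : ℕ) : Braid n :=
  if h : i < n - 1 then PresentedGroup.of ⟨i, h⟩ else 1

theorem sigma_braid {n i : ℕ} (h : i + 1 < n - 1) :
    sigma n i * sigma n (i + 1) * sigma n i = sigma n (i + 1) * sigma n i * sigma n (i + 1) := by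
  have h' : i < n - 1 := by omega
  simp only [sigma, h, h', dif_pos]
  exact PresentedGroup.mk_eq_mk_of_mul_inv_mem (Or.inl ⟨⟨i, h'⟩, ⟨i + 1, h⟩, rfl, rfl⟩)

theorem sigma_comm {n i j : ℕ} (h : i + 2 ≤ j) : Commute (sigma n i) (sigma n j) := by
  by_cases hj : j < n - 1
  · have h' : i < n - 1 := by omega
    simp only [sigma, hj, h', dif_pos]
    exact PresentedGroup.mk_eq_mk_of_mul_inv_mem (Or.inr ⟨⟨i, h'⟩, ⟨j, hj⟩, h, rfl⟩)
  · simp [sigma, hj]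

/-- The homomorphism `B_n → B_m`, `b ↦ id_k ♮ b ♮ id_{m-k-n}`, that lays `k` trivial strands to the
left of a braid and `m - k - n` trivial strands to its right. -/
def incl (k n m : ℕ) (h : k + n ≤ m) : Braid n →* Braid m :=
  PresentedGroup.toGroup (f := fun i : Fin (n - 1) => sigma m (k + i)) (by
    rintro r (⟨i, j, hij, rfl⟩ | ⟨i, j, hij, rfl⟩)
    · have hj := j.2
      simp only [map_mul, map_inv, FreeGroup.lift_apply_of, mul_inv_eq_one]
      rw [← hij, ← add_assoc]
      exact sigma_braid (by omega)
    · simp only [map_mul, map_inv, FreeGroup.lift_apply_of, mul_inv_eq_one]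
      exact sigma_comm (by omega))

theorem incl_sigma {k n m : ℕ} (h : k + n ≤ m) {i : ℕ} (hi : i < n - 1) :
    incl k n m h (sigma n i) = sigma m (k + i) := by
  simp [incl, sigma, hi]

theorem braid_induction {n : ℕ} (H : Subgroup (Braid n))
    (h : ∀ i, i < n - 1 → sigma n i ∈ H) (x : Braid n) : x ∈ H :=
  PresentedGroup.generated_by _ H (fun j => by simpa [sigma] using h j j.2) x

theorem braid_hom_ext {n : ℕ} {G : Type*} [Group G] {f g : Braid n →* G}
    (h : ∀ i, i < n - 1 → f (sigma n i) = g (sigma n i)) : f = g := by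
  ext x
  simpa [sigma] using h x x.2

theorem incl_incl {k n m l p : ℕ} (h : k + n ≤ m) (h' : l + m ≤ p) (x : Braid n) :
    incl l m p h' (incl k n m h x) = incl (l + k) n p (by omega) x := by
  refine DFunLike.congr_fun (f := (incl l m p h').comp (incl k n m h)) (braid_hom_ext ?_) x
  intro i hi
  simp only [MonoidHom.comp_apply]
  rw [incl_sigma _ hi, incl_sigma _ (by omega), incl_sigma _ hi, add_assoc]

theorem incl_self {n k : ℕ} (h : k + n ≤ n) (x : Braid n) : incl k n n h x = x := by
  obtain rfl : k = 0 := by omega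
  refine DFunLike.congr_fun (g := MonoidHom.id _) (braid_hom_ext ?_) x
  intro i hi
  rw [incl_sigma _ hi]; simp

theorem incl_comm {k n k' n' m : ℕ} (h : k + n ≤ m) (h' : k' + n' ≤ m) (hk : k + n ≤ k')
    (x : Braid n) (y : Braid n') : Commute (incl k n m h x) (incl k' n' m h' y) := by
  have key : ∀ i, i < n - 1 → ∀ y, Commute (incl k' n' m h' y) (sigma m (k + i)) := by
    intro i hi y
    have := braid_induction ((Subgroup.centralizer {sigma m (k + i)}).comap (incl k' n' m h'))
      (fun j hj => by
        simp only [Subgroup.mem_comap, Subgroup.mem_centralizer_singleton_iff]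
        rw [incl_sigma _ hj]
        exact (sigma_comm (by omega)).eq.symm) y
    exact Subgroup.mem_centralizer_singleton_iff.1 (Subgroup.mem_comap.1 this)
  have := braid_induction ((Subgroup.centralizer {incl k' n' m h' y}).comap (incl k n m h))
    (fun j hj => by
      simp only [Subgroup.mem_comap, Subgroup.mem_centralizer_singleton_iff]
      rw [incl_sigma _ hj]
      exact (key j hj y).eq.symm) x
  exact Subgroup.mem_centralizer_singleton_iff.1 (Subgroup.mem_comap.1 this)

/-- `b ↦ b ♮ id_{m-n}`, from `B_n` to `B_m`. -/
abbrev tensorId {n m : ℕ} (h : n ≤ m) : Braid n →* Braid m := incl 0 n m (by omega)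

/-- `b ↦ id_{m-n} ♮ b`, from `B_n` to `B_m`. -/
abbrev idTensor {n m : ℕ} (h : n ≤ m) : Braid n →* Braid m := incl (m - n) n m (by omega)

/-- In `B_N`, with the usual numbering of generators, `σ_{j+m} ∘ ⋯ ∘ σ_{j+2} ∘ σ_{j+1}`. -/
def descend (N j m : ℕ) : Braid N :=
  ((List.range m).reverse.map fun i => sigma N (j + i)).prod

/-- The braiding `b_{n,m} : n ♮ m → m ♮ n` of the braid groupoid, with the usual numbering
`(σ_m ∘ ⋯ ∘ σ_1) ∘ (σ_{m+1} ∘ ⋯ ∘ σ_2) ∘ ⋯ ∘ (σ_{n+m-1} ∘ ⋯ ∘ σ_n)`. -/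
def braiding (n m : ℕ) : Braid (n + m) :=
  ((List.range n).map fun j => descend (n + m) j m).prod

/-- The element `b_{n,m} ♮ id_{N-n-m}` of `B_N`, as a word in the generators. -/
def braidingWord (N n m : ℕ) : Braid N :=
  ((List.range n).map fun j => descend N j m).prod

theorem descend_zero (N j : ℕ) : descend N j 0 = 1 := rfl

theorem descend_succ (N j m : ℕ) : descend N j (m + 1) = sigma N (j + m) * descend N j m := by
  simp [descend, List.range_succ]

theorem braidingWord_zero (N m : ℕ) : braidingWord N 0 m = 1 := rfl

theorem braidingWord_succ (N n m : ℕ) :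
    braidingWord N (n + 1) m = braidingWord N n m * descend N n m := by
  simp [braidingWord, List.range_succ]

theorem incl_descend {k n m : ℕ} (h : k + n ≤ m) (j l : ℕ) (hl : j + l ≤ n - 1) :
    incl k n m h (descend n j l) = descend m (k + j) l := by
  induction l with
  | zero => simp [descend_zero]
  | succ l ih =>
    rw [descend_succ, descend_succ, map_mul, ih (by omega), incl_sigma _ (by omega), add_assoc]

theorem tensorId_braidingWord {n m N x : ℕ} (h : N ≤ m) (hN : n + x ≤ N) :
    tensorId h (braidingWord N n x) = braidingWord m n x := by
  have : ∀ l, l ≤ n → tensorId h (braidingWord N l x) = braidingWord m l x := by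
    intro l hl
    induction l with
    | zero => simp [braidingWord_zero]
    | succ l ih =>
      rw [braidingWord_succ, braidingWord_succ, map_mul, ih (by omega), incl_descend _ _ _ (by omega)]
      simp
  exact this n le_rfl

theorem tensorId_braiding {n m N : ℕ} (h : n + m ≤ N) :
    tensorId h (braiding n m) = braidingWord N n m :=
  tensorId_braidingWord h le_rfl

theorem sigma_comm_descend {N i j l : ℕ} (h : i + 2 ≤ j ∨ j + l + 1 ≤ i) :
    Commute (sigma N i) (descend N j l) := by
  induction l with
  | zero => simp [descend_zero]
  | succ l ih =>
    rw [descend_succ]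
    refine Commute.mul_right ?_ (ih (by omega))
    rcases h with h | h
    · exact sigma_comm (by omega)
    · exact (sigma_comm (by omega)).symm

theorem descend_sigma {N j l i : ℕ} (hi : i + 1 < l) (hN : j + l < N) :
    descend N j l * sigma N (j + (i + 1)) = sigma N (j + i) * descend N j l := by
  induction l with
  | zero => omega
  | succ l ih =>
    rcases Nat.lt_or_ge (i + 1) l with h | h
    · rw [descend_succ, mul_assoc, ih h (by omega), ← mul_assoc, ← mul_assoc,
        (sigma_comm (n := N) (i := j + i) (j := j + l) (by omega)).eq]
    · obtain rfl : l = i + 1 := by omega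
      rw [descend_succ, descend_succ]
      have h1 : Commute (sigma N (j + (i + 1))) (descend N j i) :=
        sigma_comm_descend (by omega)
      have h2 := sigma_braid (n := N) (i := j + i) (by omega)
      rw [mul_assoc, mul_assoc, ← h1.eq]
      simp only [← mul_assoc]
      rw [← add_assoc, h2]

theorem braidingWord_sigma {N x k i : ℕ} (hi : i + 1 < k) (hN : x + k ≤ N) :
    braidingWord N x k * sigma N (x + i) = sigma N i * braidingWord N x k := by
  induction x with
  | zero => simp [braidingWord_zero]
  | succ x ih =>
    rw [braidingWord_succ, mul_assoc, show x + 1 + i = x + (i + 1) by omega,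
      descend_sigma hi (by omega), ← mul_assoc, ih (by omega), mul_assoc]

/-- Naturality of the braiding: `b_{x,k} ∘ (id_x ♮ g) = (g ♮ id_x) ∘ b_{x,k}`. -/
theorem braidingWord_natural {N x k : ℕ} (hN : x + k ≤ N) (g : Braid k) :
    braidingWord N x k * incl x k N hN g = incl 0 k N (by omega) g * braidingWord N x k := by
  have : incl x k N hN =
      (MulAut.conj (braidingWord N x k)⁻¹).toMonoidHom.comp (incl 0 k N (by omega)) := by
    apply braid_hom_ext
    intro i hi
    have := braidingWord_sigma (N := N) (x := x) (k := k) (i := i) (by omega) hN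
    simp only [MonoidHom.comp_apply]
    rw [incl_sigma _ hi, incl_sigma _ hi]
    simp only [MulEquiv.coe_toMonoidHom, MulAut.conj_apply, inv_inv, zero_add]
    rw [mul_assoc, ← this]
    group
  rw [this]
  simp only [MonoidHom.comp_apply, MulEquiv.coe_toMonoidHom, MulAut.conj_apply]
  group

theorem descend_add (N j a b : ℕ) :
    descend N j (a + b) = descend N (j + a) b * descend N j a := by
  induction b with
  | zero => simp [descend_zero]
  | succ b ih => rw [← add_assoc, descend_succ, descend_succ, ih, mul_assoc, add_assoc]

theorem descend_comm_descend {N i k j l : ℕ} (h : i + k + 1 ≤ j) :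
    Commute (descend N i k) (descend N j l) := by
  induction k with
  | zero => simp [descend_zero]
  | succ k ih =>
    rw [descend_succ]
    exact Commute.mul_left (sigma_comm_descend (by omega)) (ih (by omega))

theorem braidingWord_comm_descend {N x k j l : ℕ} (h : x + k ≤ j) :
    Commute (braidingWord N x k) (descend N j l) := by
  induction x with
  | zero => simp [braidingWord_zero]
  | succ x ih =>
    rw [braidingWord_succ]
    exact Commute.mul_left (ih (by omega)) (descend_comm_descend (by omega))

theorem incl_braidingWord {N M k x b : ℕ} (h : k + N ≤ M) (hN : x + b ≤ N) :
    incl k N M h (braidingWord N x b) =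
      ((List.range x).map fun j => descend M (k + j) b).prod := by
  have : ∀ l, l ≤ x → incl k N M h (braidingWord N l b) =
      ((List.range l).map fun j => descend M (k + j) b).prod := by
    intro l hl
    induction l with
    | zero => simp [braidingWord_zero]
    | succ l ih =>
      rw [braidingWord_succ, map_mul, ih (by omega), incl_descend _ _ _ (by omega)]
      simp [List.range_succ]
  exact this x le_rfl

/-- Hexagon: `b_{x,a+b} = (id_a ♮ b_{x,b}) ∘ (b_{x,a} ♮ id_b)`. -/
theorem braidingWord_hexagon {N M x a b : ℕ} (h : a + N ≤ M) (hN : x + b ≤ N) :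
    braidingWord M x (a + b) = incl a N M h (braidingWord N x b) * braidingWord M x a := by
  rw [incl_braidingWord h hN]
  clear hN h
  induction x with
  | zero => simp [braidingWord_zero]
  | succ x ih =>
    have hc : Commute (braidingWord M x a) (descend M (a + x) b) :=
      braidingWord_comm_descend (by omega)
    rw [braidingWord_succ, braidingWord_succ, ih, descend_add, List.range_succ, add_comm x a]
    simp only [List.map_append, List.map_cons, List.map_nil, List.prod_append, List.prod_cons,
      List.prod_nil, mul_one, mul_assoc]
    rw [← mul_assoc (braidingWord M x a), hc.eq, mul_assoc]

/-! ### The category `𝔘β` -/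

/-- The objects of Quillen's bracket construction `𝔘β`: natural numbers. -/
structure UBeta : Type where
  /-- The number of strands. -/
  n : ℕ

/-- The image of `B_{m-n}` in `B_m` under `g ↦ g ♮ id_n`. -/
def leftSubgroup (n m : ℕ) : Subgroup (Braid m) := (tensorId (Nat.sub_le m n)).range

theorem mem_leftSubgroup {n m j k : ℕ} (hk : j + k ≤ m - n) (h : j + k ≤ m) (g : Braid k) :
    incl j k m h g ∈ leftSubgroup n m :=
  ⟨incl j k (m - n) hk g, by rw [incl_incl]; simp only [zero_add]⟩

/-- A morphism `[m - n, f] : n → m` of `𝔘β`. It exists only if `n ≤ m`, and is then the class of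
some `f ∈ B_m`, where `f` and `f'` are identified when `f = f' ∘ (g ♮ id_n)` for some
`g ∈ B_{m-n}`. -/
@[ext]
structure UHom (X Y : UBeta) : Type where
  le : X.n ≤ Y.n
  cls : Braid Y.n ⧸ leftSubgroup X.n Y.n

/-- The morphism `[m - n, f]`. -/
def UHom.of {X Y : UBeta} (h : X.n ≤ Y.n) (f : Braid Y.n) : UHom X Y := ⟨h, (f : _ ⧸ _)⟩

theorem UHom.ind {X Y : UBeta} {p : UHom X Y → Prop}
    (h : ∀ (hle : X.n ≤ Y.n) (f : Braid Y.n), p (UHom.of hle f)) (f : UHom X Y) : p f := by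
  obtain ⟨hle, c⟩ := f
  induction c using QuotientGroup.induction_on with
  | H f => exact h hle f

theorem UHom.of_eq {X Y : UBeta} (h : X.n ≤ Y.n) {f f' : Braid Y.n}
    (hf : f⁻¹ * f' ∈ leftSubgroup X.n Y.n) : UHom.of h f = UHom.of h f' := by
  simp only [UHom.of, UHom.mk.injEq]
  exact QuotientGroup.eq.2 hf

theorem comp_rel {n m p : ℕ} (h : n ≤ m) (h' : m ≤ p) {f f' : Braid m} {g g' : Braid p}
    (hf : f⁻¹ * f' ∈ leftSubgroup n m) (hg : g⁻¹ * g' ∈ leftSubgroup m p) :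
    (g * idTensor h' f)⁻¹ * (g' * idTensor h' f') ∈ leftSubgroup n p := by
  obtain ⟨k, hk⟩ := hf
  obtain ⟨l, hl⟩ := hg
  have e1 : f' = f * tensorId (Nat.sub_le m n) k := by rw [hk]; group
  have e2 : g' = g * tensorId (Nat.sub_le p m) l := by rw [hl]; group
  have hc : Commute (tensorId (Nat.sub_le p m) l) (idTensor h' f) :=
    incl_comm _ _ (by omega) _ _
  have : (g * idTensor h' f)⁻¹ * (g' * idTensor h' f') =
      tensorId (Nat.sub_le p m) l * idTensor h' (tensorId (Nat.sub_le m n) k) := by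
    rw [e1, e2, map_mul, mul_assoc g, ← mul_assoc (tensorId _ l), hc.eq]
    group
  rw [this, incl_incl]
  exact mul_mem (mem_leftSubgroup (by omega) _ _) (mem_leftSubgroup (by omega) _ _)

/-- `[p - m, g] ∘ [m - n, f] = [p - n, g ∘ (id_{p-m} ♮ f)]`. -/
def UHom.comp {X Y Z : UBeta} (f : UHom X Y) (g : UHom Y Z) : UHom X Z where
  le := f.le.trans g.le
  cls := Quotient.map₂ (fun (b : Braid Y.n) (c : Braid Z.n) => c * idTensor g.le b)
    (fun _ _ hb _ _ hc => QuotientGroup.leftRel_apply.2 (comp_rel f.le g.le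
      (QuotientGroup.leftRel_apply.1 hb) (QuotientGroup.leftRel_apply.1 hc))) f.cls g.cls

theorem UHom.of_comp {X Y Z : UBeta} (h : X.n ≤ Y.n) (h' : Y.n ≤ Z.n) (f : Braid Y.n)
    (g : Braid Z.n) :
    (UHom.of h f).comp (UHom.of h' g) = UHom.of (h.trans h') (g * idTensor h' f) := rfl

instance : Category UBeta where
  Hom := UHom
  id X := UHom.of le_rfl 1
  comp f g := f.comp g
  id_comp f := by
    induction f using UHom.ind with
    | h hle f => rw [UHom.of_comp, map_one, mul_one]
  comp_id f := by
    induction f using UHom.ind with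
    | h hle f => rw [UHom.of_comp, one_mul, incl_self]
  assoc f g k := by
    induction f using UHom.ind with
    | h hf f =>
    induction g using UHom.ind with
    | h hg g =>
    induction k using UHom.ind with
    | h hk k =>
      simp only [UHom.of_comp, map_mul, incl_incl, mul_assoc, Nat.sub_add_sub_cancel hk hg]

/-- The morphism `[m - n, f] : n → m` of `𝔘β`. -/
def brk {X Y : UBeta} (h : X.n ≤ Y.n) (f : Braid Y.n) : X ⟶ Y := UHom.of h f

/-- A braid `b ∈ B_n`, as the endomorphism `[0, b]` of `n` in `𝔘β`. -/
def braidEnd {n : ℕ} (b : Braid n) : (⟨n⟩ : UBeta) ⟶ ⟨n⟩ := brk le_rfl b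

theorem brk_ind {X Y : UBeta} {p : (X ⟶ Y) → Prop}
    (h : ∀ (hle : X.n ≤ Y.n) (f : Braid Y.n), p (brk hle f)) (f : X ⟶ Y) : p f :=
  UHom.ind (p := p) h f

theorem brk_comp {X Y Z : UBeta} (h : X.n ≤ Y.n) (h' : Y.n ≤ Z.n) (f : Braid Y.n)
    (g : Braid Z.n) :
    brk h f ≫ brk h' g = brk (h.trans h') (g * idTensor h' f) := rfl

theorem brk_eq {X Y : UBeta} (h : X.n ≤ Y.n) {f f' : Braid Y.n}
    (hf : f⁻¹ * f' ∈ leftSubgroup X.n Y.n) : brk h f = brk h f' := UHom.of_eq h hf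

theorem brk_one {X : UBeta} : brk (X := X) le_rfl 1 = 𝟙 X := rfl

/-! ### Translation, difference functors and strong polynomial functors -/

/-- The representative `(id_x ♮ f) ∘ (b_{x,m-n}⁻¹ ♮ id_n)` of `id_x ♮ [m - n, f]`. -/
def addLeftRep (x : ℕ) {n m : ℕ} (_ : n ≤ m) (f : Braid m) : Braid (x + m) :=
  idTensor (Nat.le_add_left m x) f *
    (tensorId (by omega : x + (m - n) ≤ x + m) (braiding x (m - n)))⁻¹

theorem addLeftRep_eq (x : ℕ) {n m : ℕ} (h : n ≤ m) (f : Braid m) :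
    addLeftRep x h f = incl x m (x + m) le_rfl f * (braidingWord (x + m) x (m - n))⁻¹ := by
  rw [addLeftRep, tensorId_braiding]
  congr 2
  simp only [idTensor, Nat.add_sub_cancel]

theorem addLeft_rel (x : ℕ) {n m : ℕ} (h : n ≤ m) {f f' : Braid m}
    (hf : f⁻¹ * f' ∈ leftSubgroup n m) :
    (addLeftRep x h f)⁻¹ * addLeftRep x h f' ∈ leftSubgroup (x + n) (x + m) := by
  obtain ⟨k, hk⟩ := hf
  have e1 : f' = f * tensorId (Nat.sub_le m n) k := by rw [hk]; group
  have hn := braidingWord_natural (N := x + m) (x := x) (k := m - n) (by omega) k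
  have : (addLeftRep x h f)⁻¹ * addLeftRep x h f' = incl 0 (m - n) (x + m) (by omega) k := by
    rw [addLeftRep_eq, addLeftRep_eq, e1, map_mul, incl_incl]
    simp only [add_zero, mul_inv_rev, inv_inv]
    rw [show ∀ a b c : Braid (x + m), b * a⁻¹ * (a * c * b⁻¹) = b * c * b⁻¹ by intros; group, hn,
      mul_inv_cancel_right]
  rw [this]
  exact mem_leftSubgroup (by omega) _ _

/-- `id_x ♮ [m - n, f] = [m - n, (id_x ♮ f) ∘ (b_{x,m-n}⁻¹ ♮ id_n)]`. -/
def addLeftMap (x : ℕ) {X Y : UBeta} (f : UHom X Y) : UHom ⟨x + X.n⟩ ⟨x + Y.n⟩ where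
  le := Nat.add_le_add_left f.le x
  cls := Quotient.map (addLeftRep x f.le) (fun _ _ hb => QuotientGroup.leftRel_apply.2
    (addLeft_rel x f.le (QuotientGroup.leftRel_apply.1 hb))) f.cls

theorem addLeftRep_one (x n : ℕ) : addLeftRep x (le_refl n) 1 = 1 := by
  have : ∀ l, braidingWord (x + n) l 0 = 1 := by
    intro l
    induction l with
    | zero => rfl
    | succ l ih => rw [braidingWord_succ, ih, descend_zero, mul_one]
  rw [addLeftRep_eq, map_one, Nat.sub_self, this, inv_one, mul_one]

theorem addLeftRep_comp (x : ℕ) {n m p : ℕ} (h : n ≤ m) (h' : m ≤ p) (f : Braid m) (g : Braid p) :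
    addLeftRep x (h.trans h') (g * idTensor h' f) =
      addLeftRep x h' g * incl (p - m) (x + m) (x + p) (by omega) (addLeftRep x h f) := by
  have hx := braidingWord_hexagon (N := x + m) (M := x + p) (x := x) (a := p - m) (b := m - n)
    (by omega) (by omega)
  have hc : Commute (braidingWord (x + p) x (p - m)) (incl (p - m + x) m (x + p) (by omega) f) := by
    rw [← tensorId_braiding (by omega : x + (p - m) ≤ x + p)]
    exact incl_comm _ _ (by omega) _ _
  simp only [addLeftRep_eq, map_mul, map_inv, incl_incl]
  rw [show p - n = p - m + (m - n) by omega, hx, mul_inv_rev]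
  simp only [add_comm x (p - m), mul_assoc]
  rw [← mul_assoc (braidingWord (x + p) x (p - m))⁻¹, (hc.inv_left).eq, mul_assoc]

/-- The endofunctor `x ♮ -` of `𝔘β`. -/
abbrev addLeft (x : ℕ) : UBeta ⥤ UBeta where
  obj X := ⟨x + X.n⟩
  map f := addLeftMap x f
  map_id X := by
    change brk _ (addLeftRep x le_rfl 1) = _
    rw [addLeftRep_one]
    rfl
  map_comp {X Y Z} f g := by
    induction f using brk_ind with
    | h hf f =>
    induction g using brk_ind with
    | h hg g =>
    change brk _ (addLeftRep x (hf.trans hg) (g * idTensor hg f)) =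
      brk _ (addLeftRep x hf f) ≫ brk _ (addLeftRep x hg g)
    rw [brk_comp, addLeftRep_comp x hf hg]
    refine congrArg (brk _) ?_
    change _ = addLeftRep x hg g *
      incl (x + Z.n - (x + Y.n)) (x + Y.n) (x + Z.n) _ (addLeftRep x hf f)
    simp only [Nat.add_sub_add_left]

theorem addLeft_map_brk (x : ℕ) {X Y : UBeta} (h : X.n ≤ Y.n) (f : Braid Y.n) :
    (addLeft x).map (brk h f) = brk (Nat.add_le_add_left h x) (addLeftRep x h f) := rfl

/-- The morphism `ι_x ♮ id_n = [x, id_{x+n}] : n → x ♮ n`, where `ι_x : 0 → x` is the unique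
morphism from the initial object `0` of `𝔘β`. -/
def stab (x : ℕ) (X : UBeta) : X ⟶ (addLeft x).obj X := brk (Nat.le_add_left _ _) 1

theorem stab_naturality (x : ℕ) {X Y : UBeta} (f : X ⟶ Y) :
    f ≫ stab x Y = stab x X ≫ (addLeft x).map f := by
  induction f using brk_ind with
  | h hf f =>
  refine brk_eq (X := X) (Y := ⟨x + Y.n⟩) _ ?_
  change ((1 : Braid (x + Y.n)) * idTensor (Nat.le_add_left Y.n x) f)⁻¹ *
    (addLeftRep x hf f * idTensor (Nat.add_le_add_left hf x) 1) ∈ leftSubgroup X.n (x + Y.n)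
  rw [map_one, one_mul, mul_one, addLeftRep, ← mul_assoc, inv_mul_cancel, one_mul]
  exact inv_mem (mem_leftSubgroup (by omega) _ _)

variable (K : Type u) [CommRing K]

/-- The category `Fct(𝔘β, K-Mod)`. -/
abbrev Fct : Type (u + 1) := UBeta ⥤ ModuleCat.{u} K

variable {K}

/-- The translation functor `τ_x`, precomposition with `x ♮ -`. -/
abbrev tau (x : ℕ) : Fct K ⥤ Fct K := (Functor.whiskeringLeft _ _ _).obj (addLeft x)

/-- The natural transformation `i_x(F) : F → τ_x(F)` induced by `ι_x : 0 → x`. -/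
def iTrans (x : ℕ) (F : Fct K) : F ⟶ (tau x).obj F where
  app X := F.map (stab x X)
  naturality X Y f := by
    change F.map f ≫ F.map (stab x Y) = F.map (stab x X) ≫ F.map ((addLeft x).map f)
    rw [← F.map_comp, ← F.map_comp, stab_naturality]

/-- The difference functor `δ_x(F) = coker (i_x(F))`. -/
noncomputable def delta (x : ℕ) (F : Fct K) : Fct K := cokernel (iTrans x F)

variable (K)

/-- `polBelow K d` is `Pol^strong_{d-1}(𝔘β, K-Mod)`, the recursion being started at the degree
`d - 1 = -1`, where only the zero functors are left. -/
def polBelow : ℕ → ObjectProperty (Fct K)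
  | 0 => fun F => IsZero F
  | d + 1 => fun F => ∀ x : ℕ, polBelow d (delta x F)

/-- `Pol^strong_d(𝔘β, K-Mod)`: the strong polynomial functors of degree at most `d`. -/
def Pol (d : ℕ) : ObjectProperty (Fct K) := polBelow K (d + 1)

variable {K}

/-! ### Coherent and reliable families -/

/-- `ι_{F_{m-n}} * id_{F_n} : F_n → F_m`, onto the last `n` generators. -/
def shiftF {n m : ℕ} (h : n ≤ m) : FreeGroup (Fin n) →* FreeGroup (Fin m) :=
  FreeGroup.map fun i => ⟨m - n + i, by omega⟩

/-- `id_{F_n} * ι_{F_{m-n}} : F_n → F_m`, onto the first `n` generators. -/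
def headF {n m : ℕ} (h : n ≤ m) : FreeGroup (Fin n) →* FreeGroup (Fin m) :=
  FreeGroup.map (Fin.castLE h)

/-- Coherent families `a_n : B_n → Aut(F_n)` and `ς_n : F_n → B_{1+n}`. -/
structure Coherent (a : ∀ n, Braid n →* MulAut (FreeGroup (Fin n)))
    (s : ∀ n, FreeGroup (Fin n) →* Braid (1 + n)) : Prop where
  /-- `(id_1 ♮ [m - n, id_m]) ∘ ς_n(g) = ς_m(e_{F_{m-n}} * g) ∘ (id_1 ♮ [m - n, id_m])` in `𝔘β`. -/
  stability : ∀ (n m : ℕ) (h : n ≤ m) (g : FreeGroup (Fin n)),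
    braidEnd (s n g) ≫ (addLeft 1).map (brk (X := ⟨n⟩) (Y := ⟨m⟩) h 1) =
      (addLeft 1).map (brk (X := ⟨n⟩) (Y := ⟨m⟩) h 1) ≫ braidEnd (s m (shiftF h g))
  /-- `(ι * id_{F_n}) ∘ a_n(b) = a_m(c ♮ b) ∘ (ι * id_{F_n})`, for `b ∈ B_n` and `c ∈ B_{m-n}`;
  here `c ♮ b = (c ♮ id_n) ∘ (id_{m-n} ♮ b)`. -/
  action : ∀ (n m : ℕ) (h : n ≤ m) (b : Braid n) (c : Braid (m - n)) (g : FreeGroup (Fin n)),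
    shiftF h (a n b g) = a m (tensorId (Nat.sub_le m n) c * idTensor h b) (shiftF h g)
  /-- `(id_1 ♮ b) ∘ ς_n(g) = ς_n(a_n(b)(g)) ∘ (id_1 ♮ b)`. -/
  compat : ∀ (n : ℕ) (b : Braid n) (g : FreeGroup (Fin n)),
    idTensor (Nat.le_add_left n 1) b * s n g = s n (a n b g) * idTensor (Nat.le_add_left n 1) b

/-- Coherent families that are reliable. -/
structure Reliable (a : ∀ n, Braid n →* MulAut (FreeGroup (Fin n)))
    (s : ∀ n, FreeGroup (Fin n) →* Braid (1 + n)) : Prop extends Coherent a s where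
  /-- `a_{1+m}(b_{1,m-n}⁻¹ ♮ id_n) ∘ (ι_{F_{m-n}} * id_{F_{1+n}}) ∘ (id_{F_1} * ι_{F_n}) =
  id_{F_1} * ι_{F_m}`. -/
  braid_first : ∀ (n m : ℕ) (h : n ≤ m) (g : FreeGroup (Fin 1)),
    a (1 + m) (tensorId (by omega : 1 + (m - n) ≤ 1 + m) (braiding 1 (m - n))⁻¹)
      (shiftF (Nat.add_le_add_left h 1) (headF (Nat.le_add_right 1 n) g)) =
        headF (Nat.le_add_right 1 m) g
  /-- `a_m(id_{m-n} ♮ b) ∘ (id_{F_{m-n}} * ι_{F_n}) = id_{F_{m-n}} * ι_{F_n}` for `b ∈ B_n`. -/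
  stabilizer : ∀ (n m : ℕ) (h : n ≤ m) (b : Braid n) (g : FreeGroup (Fin (m - n))),
    a m (idTensor h b) (headF (Nat.sub_le m n) g) = headF (Nat.sub_le m n) g

/-! ### The tensor product `I_{K[G]} ⊗_{K[G]} V` -/

section AugTensor

variable (K) (G : Type) [Group G]

/-- The augmentation ideal of the group algebra `K[G]`, the kernel of the augmentation
`K[G] → K`, as a `K`-submodule of `K[G]`. -/
noncomputable def augSubmodule : Submodule K (MonoidAlgebra K G) :=
  LinearMap.ker (MonoidAlgebra.lift K K G 1).toLinearMap

/-- The augmentation ideal `I_{K[G]}`, as a type. -/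
def AugIdeal : Type u := augSubmodule K G

noncomputable instance : AddCommGroup (AugIdeal K G) :=
  inferInstanceAs (AddCommGroup (augSubmodule K G))

noncomputable instance : Module K (AugIdeal K G) :=
  inferInstanceAs (Module K (augSubmodule K G))

variable {K G} {H J : Type} [Group H] [Group J]

/-- Right multiplication by `r ∈ K[G]` on the augmentation ideal, `i ↦ i * r`. -/
noncomputable def augMul (r : MonoidAlgebra K G) : AugIdeal K G →ₗ[K] AugIdeal K G :=
  (LinearMap.mulRight K r).restrict (p := augSubmodule K G) (q := augSubmodule K G) (by
    intro x hx
    have hx' : MonoidAlgebra.lift K K G 1 x = 0 := hx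
    change MonoidAlgebra.lift K K G 1 (x * r) = 0
    rw [map_mul, hx', zero_mul])

theorem augMul_coe (r : MonoidAlgebra K G) (i : AugIdeal K G) : (augMul r i).1 = i.1 * r := rfl

/-- The map of augmentation ideals induced by a group homomorphism. -/
noncomputable def augMap (φ : G →* H) : AugIdeal K G →ₗ[K] AugIdeal K H :=
  (MonoidAlgebra.mapDomainAlgHom K K φ).toLinearMap.restrict
    (p := augSubmodule K G) (q := augSubmodule K H) (by
    intro x hx
    have hx' : MonoidAlgebra.lift K K G 1 x = 0 := hx
    have : (MonoidAlgebra.lift K K H 1).comp (MonoidAlgebra.mapDomainAlgHom K K φ) =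
        MonoidAlgebra.lift K K G 1 := by ext; simp
    exact (DFunLike.congr_fun this x).trans hx')

theorem augMap_coe (φ : G →* H) (i : AugIdeal K G) :
    (augMap φ i).1 = MonoidAlgebra.mapDomainAlgHom K K φ i.1 := rfl

theorem augMap_id : augMap (K := K) (MonoidHom.id G) = LinearMap.id := by
  ext1 i
  apply Subtype.ext
  rw [augMap_coe, MonoidAlgebra.mapDomainAlgHom_id]
  rfl

theorem augMap_comp (φ : G →* H) (ψ : H →* J) :
    augMap (K := K) (ψ.comp φ) = augMap ψ ∘ₗ augMap φ := by
  ext1 i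
  apply Subtype.ext
  rw [augMap_coe, MonoidAlgebra.mapDomainAlgHom_comp]
  rfl

variable {V W U : Type u} [AddCommGroup V] [Module K V] [AddCommGroup W] [Module K W]
  [AddCommGroup U] [Module K U]

/-- The `K`-submodule of `I_{K[G]} ⊗_K V` generated by the elements `(i · r) ⊗ v - i ⊗ (r · v)`,
for `i ∈ I_{K[G]}`, `r ∈ K[G]` and `v ∈ V`. -/
noncomputable def balanced (ρ : Representation K G V) : Submodule K (AugIdeal K G ⊗[K] V) :=
  Submodule.span K {t | ∃ (i : AugIdeal K G) (r : MonoidAlgebra K G) (v : V),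
    t = augMul r i ⊗ₜ[K] v - i ⊗ₜ[K] ρ.asAlgebraHom r v}

/-- The tensor product `I_{K[G]} ⊗_{K[G]} V` over the group algebra, where `V` is the left
`K[G]`-module given by a representation `ρ` of `G`. -/
abbrev AugTensor (ρ : Representation K G V) : Type u := (AugIdeal K G ⊗[K] V) ⧸ balanced ρ

/-- The class of `i ⊗ v` in `I_{K[G]} ⊗_{K[G]} V`. -/
noncomputable def AugTensor.tmul (ρ : Representation K G V) (i : AugIdeal K G) (v : V) :
    AugTensor ρ := (balanced ρ).mkQ (i ⊗ₜ[K] v)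

theorem asAlgebraHom_equivariant {ρ : Representation K G V} {ρ' : Representation K H W}
    {φ : G →* H} {L : V →ₗ[K] W} (hL : ∀ g v, L (ρ g v) = ρ' (φ g) (L v))
    (r : MonoidAlgebra K G) (v : V) :
    L (ρ.asAlgebraHom r v) =
      ρ'.asAlgebraHom (MonoidAlgebra.mapDomainAlgHom K K φ r) (L v) := by
  induction r using MonoidAlgebra.induction_on with
  | of g => simp [hL]
  | add x y hx hy => simp only [map_add, LinearMap.add_apply, hx, hy]
  | smul c x hx => simp only [map_smul, LinearMap.smul_apply, hx]

/-- The map `i ⊗ v ↦ φ(i) ⊗ L(v)` from `I_{K[G]} ⊗_{K[G]} V` to `I_{K[H]} ⊗_{K[H]} W`. -/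
noncomputable def augTensorMap (ρ : Representation K G V) (ρ' : Representation K H W)
    (φ : G →* H) (L : V →ₗ[K] W) (hL : ∀ g v, L (ρ g v) = ρ' (φ g) (L v)) :
    AugTensor ρ →ₗ[K] AugTensor ρ' :=
  (balanced ρ).mapQ (balanced ρ') (TensorProduct.map (augMap φ) L) (by
    rw [balanced, Submodule.span_le]
    rintro _ ⟨i, r, v, rfl⟩
    refine Submodule.subset_span
      ⟨augMap φ i, MonoidAlgebra.mapDomainAlgHom K K φ r, L v, ?_⟩
    rw [map_sub, TensorProduct.map_tmul, TensorProduct.map_tmul, asAlgebraHom_equivariant hL]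
    congr 2
    apply Subtype.ext
    rw [augMap_coe, augMul_coe, augMul_coe, map_mul, augMap_coe])

theorem augTensorMap_tmul (ρ : Representation K G V) (ρ' : Representation K H W)
    (φ : G →* H) (L : V →ₗ[K] W) (hL : ∀ g v, L (ρ g v) = ρ' (φ g) (L v)) (i : AugIdeal K G)
    (v : V) : augTensorMap ρ ρ' φ L hL (AugTensor.tmul ρ i v) =
      AugTensor.tmul ρ' (augMap φ i) (L v) := rfl

theorem AugTensor.hom_ext {ρ : Representation K G V} {f g : AugTensor ρ →ₗ[K] U}
    (h : ∀ i v, f (AugTensor.tmul ρ i v) = g (AugTensor.tmul ρ i v)) : f = g :=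
  Submodule.linearMap_qext _ (TensorProduct.ext' h)

theorem augTensorMap_id {ρ : Representation K G V} {φ : G →* G} {L : V →ₗ[K] V}
    (hL : ∀ g v, L (ρ g v) = ρ (φ g) (L v)) (hφ : φ = MonoidHom.id G) (hL' : L = LinearMap.id) :
    augTensorMap ρ ρ φ L hL = LinearMap.id := by
  subst hφ hL'
  refine AugTensor.hom_ext fun i v => ?_
  rw [augTensorMap_tmul, augMap_id]
  rfl

theorem augTensorMap_comp {ρ : Representation K G V} {ρ' : Representation K H W}
    {ρ'' : Representation K J U} {φ : G →* H} {L : V →ₗ[K] W} {φ' : H →* J} {L' : W →ₗ[K] U}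
    {φ'' : G →* J} {L'' : V →ₗ[K] U} (hL : ∀ g v, L (ρ g v) = ρ' (φ g) (L v))
    (hL' : ∀ g v, L' (ρ' g v) = ρ'' (φ' g) (L' v))
    (hL'' : ∀ g v, L'' (ρ g v) = ρ'' (φ'' g) (L'' v))
    (h : φ'' = φ'.comp φ) (h' : L'' = L' ∘ₗ L) :
    augTensorMap ρ ρ'' φ'' L'' hL'' =
      augTensorMap ρ' ρ'' φ' L' hL' ∘ₗ augTensorMap ρ ρ' φ L hL := by
  subst h h'
  refine AugTensor.hom_ext fun i v => ?_
  rw [LinearMap.comp_apply, augTensorMap_tmul, augTensorMap_tmul, augTensorMap_tmul, augMap_comp]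
  rfl

end AugTensor

/-! ### The Long-Moody functor -/

section LM

variable {a : ∀ n, Braid n →* MulAut (FreeGroup (Fin n))}
  {s : ∀ n, FreeGroup (Fin n) →* Braid (1 + n)}

/-- The homomorphism `a_m(b) ∘ (ι_{F_{m-n}} * id_{F_n}) : F_n → F_m` associated with the morphism
`[m - n, b]` of `𝔘β`. -/
def freeMap (hc : Coherent a s) {X Y : UBeta} (f : UHom X Y) :
    FreeGroup (Fin X.n) →* FreeGroup (Fin Y.n) :=
  Quotient.lift (fun b : Braid Y.n => (a Y.n b).toMonoidHom.comp (shiftF f.le)) (by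
    intro b b' hb
    obtain ⟨k, hk⟩ := QuotientGroup.leftRel_apply.1 hb
    have e : b' = b * tensorId (Nat.sub_le Y.n X.n) k := by rw [hk]; group
    ext1 i
    have := hc.action X.n Y.n f.le 1 k (FreeGroup.of i)
    rw [map_one, map_one, mul_one, MulAut.one_apply] at this
    simp only [MonoidHom.comp_apply, MulEquiv.coe_toMonoidHom]
    rw [e, map_mul, MulAut.mul_apply, ← this]) f.cls

theorem freeMap_brk (hc : Coherent a s) {X Y : UBeta} (h : X.n ≤ Y.n) (b : Braid Y.n) :
    freeMap hc (brk h b) = (a Y.n b).toMonoidHom.comp (shiftF h) := rfl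

theorem shiftF_shiftF {n m p : ℕ} (h : n ≤ m) (h' : m ≤ p) (g : FreeGroup (Fin n)) :
    shiftF h' (shiftF h g) = shiftF (h.trans h') g := by
  simp only [shiftF]
  rw [FreeGroup.map.comp]
  congr 2
  funext i
  apply Fin.ext
  simp only [Function.comp]
  omega

theorem freeMap_id (hc : Coherent a s) (X : UBeta) : freeMap hc (𝟙 X) = MonoidHom.id _ := by
  rw [← brk_one, freeMap_brk, map_one]
  ext1 i
  simp [shiftF]

theorem freeMap_comp (hc : Coherent a s) {X Y Z : UBeta} (f : X ⟶ Y) (g : Y ⟶ Z) :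
    freeMap hc (f ≫ g) = (freeMap hc g).comp (freeMap hc f) := by
  induction f using brk_ind with
  | h hf f =>
  induction g using brk_ind with
  | h hg g =>
  rw [brk_comp, freeMap_brk, freeMap_brk, freeMap_brk]
  ext1 i
  have := hc.action Y.n Z.n hg f 1 (shiftF hf (FreeGroup.of i))
  rw [map_one, one_mul] at this
  simp only [MonoidHom.comp_apply, MulEquiv.coe_toMonoidHom, map_mul, MulAut.mul_apply]
  rw [this, shiftF_shiftF]

/-- The action of `F_n` on `F(1 + n)` through `ς_n : F_n → B_{1+n}`. -/
def lmRep (s : ∀ n, FreeGroup (Fin n) →* Braid (1 + n)) (F : Fct K) (X : UBeta) :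
    Representation K (FreeGroup (Fin X.n)) (F.obj ⟨1 + X.n⟩) where
  toFun g := (F.map (braidEnd (s X.n g))).hom
  map_one' := by
    rw [map_one]
    exact congrArg ModuleCat.Hom.hom (F.map_id _)
  map_mul' g g' := by
    have : braidEnd (s X.n (g * g')) = braidEnd (s X.n g') ≫ braidEnd (s X.n g) := by
      rw [braidEnd, braidEnd, braidEnd, brk_comp, map_mul, incl_self]
    rw [this, F.map_comp]
    rfl

theorem addLeft_map_comp_end {n m : ℕ} (h : n ≤ m) (b : Braid m) (c : Braid (1 + m)) :
    (addLeft 1).map (brk (X := ⟨n⟩) (Y := ⟨m⟩) h b) ≫ braidEnd c =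
      brk (X := ⟨1 + n⟩) (Y := ⟨1 + m⟩) (Nat.add_le_add_left h 1) (c * addLeftRep 1 h b) := by
  refine (brk_comp (X := ⟨1 + n⟩) (Y := ⟨1 + m⟩) (Z := ⟨1 + m⟩) _ le_rfl _ _).trans ?_
  rw [incl_self]

theorem addLeft_map_eq {n m : ℕ} (h : n ≤ m) (b : Braid m) :
    (addLeft 1).map (brk (X := ⟨n⟩) (Y := ⟨m⟩) h b) =
      (addLeft 1).map (brk (X := ⟨n⟩) (Y := ⟨m⟩) h 1) ≫
        braidEnd (idTensor (Nat.le_add_left m 1) b) := by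
  rw [addLeft_map_comp_end, addLeft_map_brk, addLeftRep, addLeftRep, map_one, one_mul]

theorem braidEnd_comp {n : ℕ} (b c : Braid n) : braidEnd b ≫ braidEnd c = braidEnd (c * b) := by
  rw [braidEnd, braidEnd, brk_comp, incl_self]
  rfl

theorem braidEnd_brk (hc : Coherent a s) {X Y : UBeta} (f : X ⟶ Y) (g : FreeGroup (Fin X.n)) :
    braidEnd (s X.n g) ≫ (addLeft 1).map f =
      (addLeft 1).map f ≫ braidEnd (s Y.n (freeMap hc f g)) := by
  induction f using brk_ind with
  | h hf b =>
  obtain ⟨n⟩ := X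
  obtain ⟨m⟩ := Y
  rw [addLeft_map_eq, ← Category.assoc]
  refine (congrArg (· ≫ _) (hc.stability n m hf g)).trans ?_
  refine (Category.assoc _ _ _).trans ?_
  refine Eq.trans ?_ (Category.assoc _ _ _).symm
  refine congrArg (_ ≫ ·) ?_
  refine (braidEnd_comp _ _).trans (Eq.trans ?_ (braidEnd_comp _ _).symm)
  exact congrArg braidEnd (hc.compat m b (shiftF hf g))

/-- The linear map `F(id_1 ♮ f) : F(1 + n) → F(1 + m)`, for `f : n → m` in `𝔘β`. -/
def lmMap (F : Fct K) {X Y : UBeta} (f : X ⟶ Y) :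
    F.obj ⟨1 + X.n⟩ →ₗ[K] F.obj ⟨1 + Y.n⟩ := (F.map ((addLeft 1).map f)).hom

theorem lmMap_id (F : Fct K) (X : UBeta) : lmMap F (𝟙 X) = LinearMap.id := by
  rw [lmMap, CategoryTheory.Functor.map_id, CategoryTheory.Functor.map_id]
  rfl

theorem lmMap_comp (F : Fct K) {X Y Z : UBeta} (f : X ⟶ Y) (g : Y ⟶ Z) :
    lmMap F (f ≫ g) = lmMap F g ∘ₗ lmMap F f := by
  rw [lmMap, CategoryTheory.Functor.map_comp, CategoryTheory.Functor.map_comp]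
  rfl

theorem lmRep_equivariant (hc : Coherent a s) (F : Fct K) {X Y : UBeta} (f : X ⟶ Y)
    (g : FreeGroup (Fin X.n)) (v : F.obj ⟨1 + X.n⟩) :
    lmMap F f (lmRep s F X g v) = lmRep s F Y (freeMap hc f g) (lmMap F f v) := by
  have h := congrArg (fun k => F.map k) (braidEnd_brk hc f g)
  have h' := ((F.map_comp _ _).symm.trans h).trans (F.map_comp _ _)
  exact congrArg (fun k => k.hom v) h'

/-- For `f = [m - n, b] : n → m` in `𝔘β`, the map
`i ⊗ v ↦ a_m(b)((ι_{F_{m-n}} * id_{F_n})(i)) ⊗ F(id_1 ♮ f)(v)` from `I_{K[F_n]} ⊗ F(1 + n)` to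
`I_{K[F_m]} ⊗ F(1 + m)`. -/
noncomputable def lmMorph (hc : Coherent a s) (F : Fct K) {X Y : UBeta} (f : X ⟶ Y) :
    AugTensor (lmRep s F X) →ₗ[K] AugTensor (lmRep s F Y) :=
  augTensorMap (lmRep s F X) (lmRep s F Y) (freeMap hc f) (lmMap F f) (lmRep_equivariant hc F f)

theorem lmMorph_id (hc : Coherent a s) (F : Fct K) (X : UBeta) :
    lmMorph hc F (𝟙 X) = LinearMap.id :=
  augTensorMap_id (lmRep_equivariant hc F (𝟙 X)) (freeMap_id hc X) (lmMap_id F X)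

theorem lmMorph_comp (hc : Coherent a s) (F : Fct K) {X Y Z : UBeta} (f : X ⟶ Y) (g : Y ⟶ Z) :
    lmMorph hc F (f ≫ g) = lmMorph hc F g ∘ₗ lmMorph hc F f :=
  augTensorMap_comp (lmRep_equivariant hc F f) (lmRep_equivariant hc F g)
    (lmRep_equivariant hc F (f ≫ g)) (freeMap_comp hc f g) (lmMap_comp F f g)

theorem lmRep_natural {F G : Fct K} (η : F ⟶ G) (X : UBeta) (g : FreeGroup (Fin X.n))
    (v : F.obj ⟨1 + X.n⟩) :
    (η.app ⟨1 + X.n⟩).hom (lmRep s F X g v) =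
      lmRep s G X (MonoidHom.id _ g) ((η.app ⟨1 + X.n⟩).hom v) :=
  congrArg (fun k => k.hom v) (η.naturality (braidEnd (s X.n g)))

theorem lmMap_natural {F G : Fct K} (η : F ⟶ G) {X Y : UBeta} (f : X ⟶ Y) :
    (η.app ⟨1 + Y.n⟩).hom ∘ₗ lmMap F f = lmMap G f ∘ₗ (η.app ⟨1 + X.n⟩).hom :=
  congrArg (fun k => k.hom) (η.naturality ((addLeft 1).map f))

/-- The map `id ⊗ η_{1+n}` from `I_{K[F_n]} ⊗ F(1 + n)` to `I_{K[F_n]} ⊗ G(1 + n)`. -/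
noncomputable def lmNat (s : ∀ n, FreeGroup (Fin n) →* Braid (1 + n)) {F G : Fct K} (η : F ⟶ G)
    (X : UBeta) : AugTensor (lmRep s F X) →ₗ[K] AugTensor (lmRep s G X) :=
  augTensorMap (lmRep s F X) (lmRep s G X) (MonoidHom.id _) (η.app ⟨1 + X.n⟩).hom
    (lmRep_natural η X)

theorem lmNat_naturality (hc : Coherent a s) {F G : Fct K} (η : F ⟶ G) {X Y : UBeta} (f : X ⟶ Y) :
    lmNat s η Y ∘ₗ lmMorph hc F f = lmMorph hc G f ∘ₗ lmNat s η X := by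
  have hL : ∀ g v, ((η.app ⟨1 + Y.n⟩).hom ∘ₗ lmMap F f) (lmRep s F X g v) =
      lmRep s G Y (freeMap hc f g) (((η.app ⟨1 + Y.n⟩).hom ∘ₗ lmMap F f) v) := by
    intro g v
    rw [LinearMap.comp_apply, lmRep_equivariant hc, lmRep_natural]
    rfl
  exact (augTensorMap_comp (lmRep_equivariant hc F f) (lmRep_natural η Y) hL
      (MonoidHom.id_comp _).symm rfl).symm.trans
    (augTensorMap_comp (lmRep_natural η X) (lmRep_equivariant hc G f) hL
      (MonoidHom.comp_id _).symm (lmMap_natural η f))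

/-- The functor `LM(F)`, with values `I_{K[F_n]} ⊗_{K[F_n]} F(1 + n)`. -/
noncomputable def LMobj (hc : Coherent a s) (F : Fct K) : Fct K where
  obj X := ModuleCat.of K (AugTensor (lmRep s F X))
  map f := ModuleCat.ofHom (lmMorph hc F f)
  map_id X := ModuleCat.hom_ext (lmMorph_id hc F X)
  map_comp f g := ModuleCat.hom_ext (lmMorph_comp hc F f g)

/-- The natural transformation `LM(η)`. -/
noncomputable def LMmap (hc : Coherent a s) {F G : Fct K} (η : F ⟶ G) :
    LMobj hc F ⟶ LMobj hc G where
  app X := (ModuleCat.ofHom (lmNat s η X) :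
    ModuleCat.of K (AugTensor (lmRep s F X)) ⟶ ModuleCat.of K (AugTensor (lmRep s G X)))
  naturality _ _ f := ModuleCat.hom_ext (lmNat_naturality hc η f)

/-- The Long-Moody functor `LM_{a,ς}`. -/
noncomputable def LM (hc : Coherent a s) : Fct K ⥤ Fct K where
  obj F := LMobj hc F
  map η := LMmap hc η
  map_id F := NatTrans.ext (funext fun X => ModuleCat.hom_ext
    (augTensorMap_id (lmRep_natural (𝟙 F) X) rfl rfl))
  map_comp η θ := NatTrans.ext (funext fun X => ModuleCat.hom_ext
    (augTensorMap_comp (lmRep_natural η X) (lmRep_natural θ X) (lmRep_natural (η ≫ θ) X) rfl rfl))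

end LM

end LongMoody

namespace LongMoody

/-! ### The symmetry of `1 ♮ 1 ♮ -` and the composition of translations -/

/-! Two reductions make the induction work. First, it suffices to control `δ_1`. Translation by `x +
1` is a composite of translations by `x` and by `1`, which gives a right exact sequence `δ_1 F →
δ_{x+1} F → τ_1 δ_x F → 0`, so polynomiality of `δ_1 F` spreads to every `δ_x F` (`polOne_delta`,
`polBelow_iff_polOne`). Second, each `δ_x` preserves right exact sequences, so polynomial functors
of bounded degree are stable under quotients and under right exact extensions
(`polOne_of_surjective`, `polOne_of_exact`, `polOne_of_cover`). Only surjections and right exactness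
are ever needed.

Translation preserves the degree because the braiding of the two added strands is a natural
automorphism of `1 ♮ 1 ♮ -` exchanging the two ways of stabilising. It induces a surjection `τ_1 δ_1
F → δ_1 τ_1 F` (`polOne_tau_one`). The case of `τ_2` follows from `τ_2 F ≅ τ_1 τ_1 F`.

For `LM`, split `F_{1+n}` into its first generator `g_1` and the last `n` generators. The elements
`(g_1 - 1) ⊗ v` form a natural image of `τ_1 τ_1 F` in `τ_1 LM(F)`, since reliability says that `1 ♮
f` preserves `g_1` (`freeMap_firstGen`). The other generators, twisted by the braiding, give a
natural map `LM(τ_1 F) → τ_1 LM(F)` (`lmShift`), and the two images together cover the target. The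
stabilisation of `LM(F)` factors through `LM(i_1 F)` (`iTrans_LM`), and `LM` is right exact, so
modulo the image of `τ_1 τ_1 F` the functor `δ_1 LM(F)` is a quotient of `LM(δ_1 F)`. Induction on
the degree concludes (`polOne_LM`). -/

theorem incl_congr {k k' n m : ℕ} (hk : k = k') (h : k + n ≤ m) (x : Braid n) :
    incl k n m h x = incl k' n m (hk ▸ h) x := by
  subst hk; rfl

/-- Naturality of the braiding `b_{2,k}` in its first factor: it carries the crossing of the first
two strands to the crossing of the last two of its `k + 2` strands. This is what makes `swap`
natural. -/
theorem descend_mul_descend_sigma {N k : ℕ} (hk : k + 1 < N) :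
    descend N 0 k * descend N 1 k * sigma N 0 = sigma N k * (descend N 0 k * descend N 1 k) := by
  induction k with
  | zero => simp [descend_zero]
  | succ k ih =>
    have hc : Commute (sigma N (k + 1)) (descend N 0 k) := sigma_comm_descend (by omega)
    -- Peeling one strand off `b_{2,k+1}` leaves `b_{2,k}`; the two extracted generators then meet
    -- the shifted crossing in a single braid relation.
    have e : descend N 0 (k + 1) * descend N 1 (k + 1) =
        sigma N k * sigma N (k + 1) * (descend N 0 k * descend N 1 k) := by
      rw [descend_succ, descend_succ, zero_add, add_comm 1 k]
      simp only [mul_assoc]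
      rw [← mul_assoc (descend N 0 k), ← hc.eq]
      simp only [mul_assoc]
    rw [e, mul_assoc, ih (by omega), ← mul_assoc, sigma_braid (by omega)]
    simp only [mul_assoc]

theorem addLeftRep_one_eq {n m : ℕ} (h : n ≤ m) (b : Braid m) :
    addLeftRep 1 h b = incl 1 m (1 + m) le_rfl b * (descend (1 + m) 0 (m - n))⁻¹ := by
  rw [addLeftRep_eq, braidingWord_succ, braidingWord_zero, one_mul]

/-- Moving one strand and then `x` strands past the `m - n` new ones amounts to moving all `x + 1`
at once. Hence the double translation has the representative of `id_{x+1} ♮ [m - n, b]`, up to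
reassociating the sum. -/
theorem addLeftRep_addLeftRep_one (x : ℕ) {n m : ℕ} (h : n ≤ m) (b : Braid m) :
    addLeftRep x (Nat.add_le_add_left h 1) (addLeftRep 1 h b) =
      incl (x + 1) m (x + (1 + m)) (by omega) b * (braidingWord (x + (1 + m)) (x + 1) (m - n))⁻¹ := by
  rw [addLeftRep_eq, addLeftRep_one_eq, map_mul, incl_incl, map_inv,
    incl_descend _ _ _ (by omega), braidingWord_succ, Nat.add_sub_add_left, mul_inv_rev, mul_assoc,
    add_zero]

/-- The automorphism `[0, b_{1,1}⁻¹ ♮ id_n]` of `1 ♮ (1 ♮ n)`. -/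
def swap (n : ℕ) : (⟨1 + (1 + n)⟩ : UBeta) ⟶ ⟨1 + (1 + n)⟩ := braidEnd (sigma (1 + (1 + n)) 0)⁻¹

/-- The inverse of `swap n`. -/
def swapInv (n : ℕ) : (⟨1 + (1 + n)⟩ : UBeta) ⟶ ⟨1 + (1 + n)⟩ := braidEnd (sigma (1 + (1 + n)) 0)

theorem swapInv_swap (n : ℕ) : swapInv n ≫ swap n = 𝟙 _ := by
  rw [swap, swapInv, braidEnd_comp, inv_mul_cancel]
  rfl

/-- The representative of `id_1 ♮ id_1 ♮ f` is `(id_2 ♮ b)` times the inverse of `b_{2,m-n}`. The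
crossing of the first two strands commutes with `id_2 ♮ b`, and passing it through the braiding
shifts it by `m - n`, exactly as precomposition in `𝔘β` requires. -/
theorem swap_naturality {X Y : UBeta} (f : X ⟶ Y) :
    (addLeft 1).map ((addLeft 1).map f) ≫ swap Y.n =
      swap X.n ≫ (addLeft 1).map ((addLeft 1).map f) := by
  induction f using brk_ind with
  | h hf b =>
  obtain ⟨n⟩ := X
  obtain ⟨m⟩ := Y
  change n ≤ m at hf
  have e := addLeftRep_addLeftRep_one 1 hf b
  rw [braidingWord_succ, braidingWord_succ, braidingWord_zero, one_mul] at e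
  have hc : Commute (sigma (1 + (1 + m)) 0) (incl (1 + 1) m (1 + (1 + m)) (by omega) b) := by
    have := incl_comm (k := 0) (n := 2) (k' := 1 + 1) (n' := m) (m := 1 + (1 + m)) (by omega)
      (by omega) (by omega) (sigma 2 0) b
    rwa [incl_sigma _ (by omega)] at this
  change brk _ ((sigma (1 + (1 + m)) 0)⁻¹ * incl _ _ _ _ (addLeftRep 1 _ (addLeftRep 1 hf b))) =
    brk _ (addLeftRep 1 _ (addLeftRep 1 hf b) *
      incl (1 + (1 + m) - (1 + (1 + n))) (1 + (1 + n)) (1 + (1 + m)) _ (sigma (1 + (1 + n)) 0)⁻¹)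
  refine congrArg (brk _) ?_
  rw [incl_self, e, map_inv, incl_sigma _ (by omega),
    show 1 + (1 + m) - (1 + (1 + n)) + 0 = m - n by omega]
  have hd := descend_mul_descend_sigma (N := 1 + (1 + m)) (k := m - n) (by omega)
  rw [← mul_assoc, (hc.inv_left).eq, mul_assoc, mul_assoc, ← mul_inv_rev, ← mul_inv_rev, hd]

/-- The swap turns the stabilisation inserting a strand in first position into the one inserting it
in second position. This reconciles `i_1(τ_1 F)` with `τ_1(i_1 F)`. -/
theorem stab_swap (X : UBeta) :
    stab 1 ((addLeft 1).obj X) ≫ swap X.n = (addLeft 1).map (stab 1 X) := by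
  obtain ⟨n⟩ := X
  change brk _ ((sigma (1 + (1 + n)) 0)⁻¹ * incl _ _ _ _ 1) = brk _ (addLeftRep 1 _ 1)
  refine congrArg (brk _) ?_
  rw [map_one, mul_one, addLeftRep_one_eq, map_one, one_mul]
  change _ = (descend (1 + (1 + n)) 0 (1 + n - n))⁻¹
  rw [Nat.add_sub_cancel, descend_succ, descend_zero, mul_one]

/-- The isomorphism `x ♮ (1 ♮ n) ≅ (x + 1) ♮ n`, natural in `n`. -/
def addLeftIso (x : ℕ) : addLeft 1 ⋙ addLeft x ≅ addLeft (x + 1) :=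
  NatIso.ofComponents (fun X =>
    { hom := brk (X := ⟨x + (1 + X.n)⟩) (Y := ⟨x + 1 + X.n⟩) (Nat.add_assoc x 1 X.n).ge 1
      inv := brk (X := ⟨x + 1 + X.n⟩) (Y := ⟨x + (1 + X.n)⟩) (Nat.add_assoc x 1 X.n).le 1
      hom_inv_id := by
        rw [brk_comp, map_one, mul_one]
        rfl
      inv_hom_id := by
        rw [brk_comp, map_one, mul_one]
        rfl }) (by
    intro X Y f
    induction f using brk_ind with
    | h hf b =>
    obtain ⟨n⟩ := X
    obtain ⟨m⟩ := Y
    change n ≤ m at hf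
    change brk _ (1 * incl (x + 1 + m - (x + (1 + m))) (x + (1 + m)) (x + 1 + m) _
        (addLeftRep x _ (addLeftRep 1 hf b))) =
      brk _ (addLeftRep (x + 1) hf b * incl _ _ _ _ 1)
    -- The two ambient braid groups have sizes that are equal only by associativity, so both
    -- components are identity braids, and the comparison is an inclusion with zero strands added.
    refine congrArg (brk _) ?_
    refine (one_mul _).trans (Eq.trans ?_ ((congrArg (_ * ·) (map_one _)).trans (mul_one _)).symm)
    refine (congrArg _ (addLeftRep_addLeftRep_one x hf b)).trans ?_
    rw [addLeftRep_eq, map_mul, incl_incl,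
      map_inv, incl_congr (show x + 1 + m - (x + (1 + m)) = 0 by omega),
      incl_congr (show x + 1 + m - (x + (1 + m)) + (x + 1) = x + 1 by omega),
      tensorId_braidingWord (by omega) (by omega)])

/-- All representatives are identity braids: adding one strand and then `x` strands is adding `x +
1`. -/
theorem stab_stab (x : ℕ) (X : UBeta) :
    stab 1 X ≫ stab x ((addLeft 1).obj X) ≫ (addLeftIso x).hom.app X = stab (x + 1) X := by
  obtain ⟨n⟩ := X
  change brk _ (1 * incl _ _ _ _ 1 * incl _ _ _ _ 1) = brk _ 1
  simp only [map_one, mul_one]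

/-- This is the stability axiom for adding a single strand, upgraded from an equality of classes to
one of braids. It makes the swap intertwine the two actions of `F_n`, as `lmShift` needs. -/
theorem braidEnd_swap {a : ∀ n, Braid n →* MulAut (FreeGroup (Fin n))}
    {s : ∀ n, FreeGroup (Fin n) →* Braid (1 + n)} (hc : Coherent a s) (n : ℕ)
    (g : FreeGroup (Fin n)) :
    (addLeft 1).map (braidEnd (s n g)) ≫ swap n =
      swap n ≫ braidEnd (s (1 + n) (shiftF (Nat.le_add_left n 1) g)) := by
  have h := hc.stability n (1 + n) (Nat.le_add_left n 1) g
  have hi := congrArg UHom.cls h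
  change QuotientGroup.mk (s := leftSubgroup (1 + n) (1 + (1 + n)))
      (addLeftRep 1 (Nat.le_add_left n 1) 1 *
        incl (1 + (1 + n) - (1 + n)) (1 + n) (1 + (1 + n)) _ (s n g)) =
    QuotientGroup.mk (s := leftSubgroup (1 + n) (1 + (1 + n)))
      (s (1 + n) (shiftF (Nat.le_add_left n 1) g) *
        incl _ _ _ _ (addLeftRep 1 (Nat.le_add_left n 1) 1)) at hi
  obtain ⟨k, hk⟩ := QuotientGroup.eq.1 hi
  -- The ambiguity of representatives lies in the image of `B_1`, which has no generators.
  have hk1 : k = 1 := by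
    have := braid_induction (n := 1 + (1 + n) - (1 + n)) ⊥ (fun i hi => by omega) k
    simpa using this
  rw [hk1, map_one, eq_comm, inv_mul_eq_one, incl_self, addLeftRep_one_eq, map_one, one_mul,
    Nat.add_sub_cancel, descend_succ, descend_zero, mul_one,
    incl_congr (show 1 + (1 + n) - (1 + n) = 1 by omega)] at hk
  change brk _ ((sigma (1 + (1 + n)) 0)⁻¹ * incl _ _ _ _ (addLeftRep 1 le_rfl (s n g))) =
    brk _ (s (1 + n) (shiftF (Nat.le_add_left n 1) g) * incl _ _ _ _ (sigma (1 + (1 + n)) 0)⁻¹)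
  refine congrArg (brk _) ?_
  rw [incl_self, incl_self, addLeftRep_one_eq, Nat.sub_self, descend_zero, inv_one, mul_one]
  exact hk

variable {K : Type u} [CommRing K]

/-! ### Pointwise description of cokernels -/

theorem app_surjective_of_epi {F G : Fct K} (η : F ⟶ G) [Epi η] (X : UBeta) :
    Function.Surjective (η.app X) :=
  (ModuleCat.epi_iff_surjective _).1 inferInstance

theorem epi_of_app_surjective {F G : Fct K} {η : F ⟶ G}
    (h : ∀ X, Function.Surjective (η.app X)) : Epi η := by
  have : ∀ X, Epi (η.app X) := fun X => (ModuleCat.epi_iff_surjective _).2 (h X)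
  exact NatTrans.epi_of_epi_app η

theorem comp_app_apply {F G H : Fct K} (η : F ⟶ G) (θ : G ⟶ H) (X : UBeta) (v : F.obj X) :
    (η ≫ θ).app X v = θ.app X (η.app X v) := rfl

theorem naturality_apply {F G : Fct K} (η : F ⟶ G) {X Y : UBeta} (f : X ⟶ Y) (v : F.obj X) :
    η.app Y (F.map f v) = G.map f (η.app X v) :=
  congrArg (fun k => k.hom v) (η.naturality f)

theorem cokernel_π_surjective {F G : Fct K} (η : F ⟶ G) (X : UBeta) :
    Function.Surjective ((cokernel.π η).app X) := app_surjective_of_epi _ X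

theorem cokernel_π_app_apply {F G : Fct K} (η : F ⟶ G) (X : UBeta) (v : F.obj X) :
    (cokernel.π η).app X (η.app X v) = 0 := by
  rw [← comp_app_apply, cokernel.condition]
  rfl

theorem exists_of_cokernel_π_eq_zero {F G : Fct K} (η : F ⟶ G) (X : UBeta) (w : G.obj X)
    (hw : (cokernel.π η).app X w = 0) : ∃ v, η.app X v = w := by
  -- Evaluation at an object is exact, so cokernels are computed pointwise.
  have h := (ShortComplex.exact_cokernel η).map ((evaluation UBeta (ModuleCat.{u} K)).obj X)
  exact (ShortComplex.moduleCat_exact_iff _).1 h w hw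

/-- An epimorphism in an abelian category is the cokernel of its kernel, and both hypotheses can be
tested on elements. This produces the maps out of difference functors used below. -/
theorem exists_desc {E A B : Fct K} (p : E ⟶ A) (q : E ⟶ B)
    (hp : ∀ X, Function.Surjective (p.app X))
    (h : ∀ X v, p.app X v = 0 → q.app X v = 0) : ∃ r : A ⟶ B, p ≫ r = q := by
  have := epi_of_app_surjective hp
  have hk : kernel.ι p ≫ q = 0 := by
    refine NatTrans.ext (funext fun X => ModuleCat.hom_ext (LinearMap.ext fun v => ?_))
    refine h X ((kernel.ι p).app X v) ?_
    rw [← comp_app_apply, kernel.condition]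
    rfl
  exact ⟨Abelian.epiDesc p q hk, Abelian.comp_epiDesc p q hk⟩

theorem isZero_of_apply {F : Fct K} (h : ∀ X (v : F.obj X), v = 0) : IsZero F :=
  (IsZero.iff_id_eq_zero F).2
    (NatTrans.ext (funext fun X => ModuleCat.hom_ext (LinearMap.ext fun v => h X v)))

theorem apply_eq_zero_of_isZero {F : Fct K} (h : IsZero F) (X : UBeta) (v : F.obj X) : v = 0 := by
  have := congrArg (fun k : F ⟶ F => k.app X v) ((IsZero.iff_id_eq_zero F).1 h)
  exact this

/-! ### Difference functors -/

/-- The projection `τ_x(F) → δ_x(F)`. -/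
noncomputable def deltaπ (x : ℕ) (F : Fct K) : (tau x).obj F ⟶ delta x F := cokernel.π (iTrans x F)

theorem deltaπ_surjective (x : ℕ) (F : Fct K) (X : UBeta) :
    Function.Surjective ((deltaπ x F).app X) := cokernel_π_surjective _ X

theorem deltaπ_stab (x : ℕ) (F : Fct K) (X : UBeta) (v : F.obj X) :
    (deltaπ x F).app X (F.map (stab x X) v) = 0 := cokernel_π_app_apply (iTrans x F) X v

theorem exists_of_deltaπ_eq_zero (x : ℕ) (F : Fct K) (X : UBeta) (w : F.obj ((addLeft x).obj X))
    (hw : (deltaπ x F).app X w = 0) : ∃ v, F.map (stab x X) v = w :=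
  exists_of_cokernel_π_eq_zero (iTrans x F) X w hw

theorem iTrans_naturality (x : ℕ) {F G : Fct K} (η : F ⟶ G) :
    iTrans x F ≫ (tau x).map η = η ≫ iTrans x G :=
  NatTrans.ext (funext fun X => η.naturality (stab x X))

/-- The natural transformation `δ_x(η)`. -/
noncomputable def deltaMap (x : ℕ) {F G : Fct K} (η : F ⟶ G) : delta x F ⟶ delta x G :=
  cokernel.map _ _ η ((tau x).map η) (iTrans_naturality x η)

theorem deltaπ_deltaMap (x : ℕ) {F G : Fct K} (η : F ⟶ G) (X : UBeta)
    (v : F.obj ((addLeft x).obj X)) :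
    (deltaMap x η).app X ((deltaπ x F).app X v) =
      (deltaπ x G).app X (η.app ((addLeft x).obj X) v) := by
  have h : deltaπ x F ≫ deltaMap x η = (tau x).map η ≫ deltaπ x G := cokernel.π_desc _ _ _
  exact congrArg (fun k => k.app X v) h

theorem deltaMap_surjective (x : ℕ) {F G : Fct K} (η : F ⟶ G)
    (h : ∀ X, Function.Surjective (η.app X)) (X : UBeta) :
    Function.Surjective ((deltaMap x η).app X) := by
  intro w
  obtain ⟨g, rfl⟩ := deltaπ_surjective x G X w
  obtain ⟨f, rfl⟩ := h _ g
  exact ⟨_, deltaπ_deltaMap x η X f⟩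

theorem isZero_delta (x : ℕ) {F : Fct K} (h : IsZero F) : IsZero (delta x F) := by
  refine isZero_of_apply fun X w => ?_
  obtain ⟨v, rfl⟩ := deltaπ_surjective x F X w
  rw [apply_eq_zero_of_isZero h _ v, map_zero]

/-- The difference functors `δ_x` preserve right exact sequences `A → G → B → 0`. -/
theorem delta_exact (x : ℕ) {A G B : Fct K} (α : A ⟶ G) (β : G ⟶ B)
    (hβ : ∀ X, Function.Surjective (β.app X))
    (h : ∀ X g, β.app X g = 0 → ∃ v, α.app X v = g) (X : UBeta) (w : (delta x G).obj X)
    (hw : (deltaMap x β).app X w = 0) : ∃ v, (deltaMap x α).app X v = w := by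
  obtain ⟨g, rfl⟩ := deltaπ_surjective x G X w
  rw [deltaπ_deltaMap] at hw
  obtain ⟨b, hb⟩ := exists_of_deltaπ_eq_zero x B X _ hw
  obtain ⟨g', rfl⟩ := hβ X b
  rw [← naturality_apply] at hb
  -- Here `β(g)` is the stabilisation of `β(g')`, so `g` minus the stabilisation of `g'` lies in the
  -- kernel of `β`; it has the same class as `g` in `δ_x(G)`.
  obtain ⟨v, hv⟩ := h ((addLeft x).obj X)
    (HSub.hSub (α := G.obj ((addLeft x).obj X)) g (G.map (stab x X) g'))
    (by rw [map_sub, hb, sub_self])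
  refine ⟨(deltaπ x A).app X v, ?_⟩
  rw [deltaπ_deltaMap, hv, map_sub, deltaπ_stab, sub_zero]

/-! ### Polynomiality is detected by `δ_1` -/

variable (K) in
/-- The analogue of `polBelow` whose recursion only uses the difference functor `δ_1`. -/
def polOne : ℕ → ObjectProperty (Fct K)
  | 0 => fun F => IsZero F
  | d + 1 => fun F => polOne d (delta 1 F)

theorem polOne_of_polBelow {d : ℕ} {F : Fct K} (h : polBelow K d F) : polOne K d F := by
  induction d generalizing F with
  | zero => exact h
  | succ d ih => exact ih (h 1)

theorem polOne_of_isZero {d : ℕ} {F : Fct K} (h : IsZero F) : polOne K d F := by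
  induction d generalizing F with
  | zero => exact h
  | succ d ih => exact ih (isZero_delta 1 h)

/-- If `A → G → B → 0` is exact, `A` and `B` being polynomial, then `G` is polynomial. -/
theorem polOne_of_exact {d : ℕ} {A G B : Fct K} (α : A ⟶ G) (β : G ⟶ B)
    (hβ : ∀ X, Function.Surjective (β.app X))
    (h : ∀ X g, β.app X g = 0 → ∃ v, α.app X v = g) (hA : polOne K d A) (hB : polOne K d B) :
    polOne K d G := by
  induction d generalizing A G B with
  | zero =>
    refine isZero_of_apply fun X g => ?_
    obtain ⟨v, rfl⟩ := h X g (apply_eq_zero_of_isZero hB X _)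
    rw [apply_eq_zero_of_isZero hA X v, map_zero]
  | succ d ih =>
    exact ih (deltaMap 1 α) (deltaMap 1 β) (deltaMap_surjective 1 β hβ)
      (delta_exact 1 α β hβ h) hA hB

/-- Quotients inherit polynomiality because `δ_1` preserves surjections. -/
theorem polOne_of_surjective {d : ℕ} {F G : Fct K} (η : F ⟶ G)
    (h : ∀ X, Function.Surjective (η.app X)) (hF : polOne K d F) : polOne K d G := by
  induction d generalizing F G with
  | zero =>
    refine isZero_of_apply fun X g => ?_
    obtain ⟨v, rfl⟩ := h X g
    rw [apply_eq_zero_of_isZero hF X v, map_zero]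
  | succ d ih => exact ih (deltaMap 1 η) (deltaMap_surjective 1 η h) hF

theorem polOne_of_iso {d : ℕ} {F G : Fct K} (e : F ≅ G) (hF : polOne K d F) : polOne K d G :=
  polOne_of_surjective e.hom (app_surjective_of_epi e.hom) hF

/-- A functor is polynomial if it is jointly covered by a polynomial functor `A` and a functor `E`
such that the map from `E` factors, modulo the image of `A`, through a polynomial quotient `Q` of
`E`. -/
theorem polOne_of_cover {d : ℕ} {A E G Q : Fct K} (α : A ⟶ G) (β : E ⟶ G) (p : E ⟶ Q)
    (hp : ∀ X, Function.Surjective (p.app X))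
    (hpβ : ∀ X v, p.app X v = 0 → ∃ w, α.app X w = β.app X v)
    (hαβ : ∀ X g, ∃ v w, α.app X v + β.app X w = g) (hA : polOne K d A) (hQ : polOne K d Q) :
    polOne K d G := by
  -- The kernel of `p` dies in `coker α`, so `E → coker α` descends to `Q`. Joint covering makes the
  -- descended map onto, and `A → G → coker α → 0` is then a right exact extension.
  obtain ⟨r, hr⟩ := exists_desc p (β ≫ cokernel.π α) hp (fun X v hv => by
    obtain ⟨w, hw⟩ := hpβ X v hv
    rw [comp_app_apply, ← hw, cokernel_π_app_apply])
  refine polOne_of_exact α (cokernel.π α) (cokernel_π_surjective α)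
    (exists_of_cokernel_π_eq_zero α) hA (polOne_of_surjective r (fun X b => ?_) hQ)
  obtain ⟨g, rfl⟩ := cokernel_π_surjective α X b
  obtain ⟨v, w, rfl⟩ := hαβ X g
  refine ⟨p.app X w, ?_⟩
  rw [← comp_app_apply, hr, map_add, cokernel_π_app_apply, zero_add, comp_app_apply]

/-! ### Translations -/

/-- The automorphism of `τ_1(τ_1(F))` given by the braiding. -/
def swapTrans (F : Fct K) : (tau 1).obj ((tau 1).obj F) ⟶ (tau 1).obj ((tau 1).obj F) where
  app X := F.map (swap X.n)
  naturality X Y f := by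
    change F.map ((addLeft 1).map ((addLeft 1).map f)) ≫ F.map (swap Y.n) =
      F.map (swap X.n) ≫ F.map ((addLeft 1).map ((addLeft 1).map f))
    rw [← F.map_comp, ← F.map_comp, swap_naturality]

theorem swapTrans_surjective (F : Fct K) (X : UBeta) :
    Function.Surjective ((swapTrans F).app X) := by
  intro v
  refine ⟨F.map (swapInv X.n) v, ?_⟩
  have h := (F.map_comp (swapInv X.n) (swap X.n)).symm.trans
    ((congrArg F.map (swapInv_swap X.n)).trans (F.map_id _))
  exact congrArg (fun k => k.hom v) h

theorem map_map_apply (F : Fct K) {X Y Z : UBeta} (f : X ⟶ Y) (g : Y ⟶ Z) (v : F.obj X) :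
    F.map g (F.map f v) = F.map (f ≫ g) v := by
  rw [F.map_comp]
  rfl

theorem polOne_tau_one {d : ℕ} {F : Fct K} (hF : polOne K d F) : polOne K d ((tau 1).obj F) := by
  induction d generalizing F with
  | zero => exact isZero_of_apply fun X v => apply_eq_zero_of_isZero hF _ v
  | succ d ih =>
    -- Both `τ_1 δ_1 F` and `δ_1 τ_1 F` are quotients of `τ_1 τ_1 F`, by the images of the two
    -- stabilisations that the swap exchanges; the swap therefore induces a surjection from the
    -- first to the second.
    obtain ⟨r, hr⟩ := exists_desc ((tau 1).map (deltaπ 1 F))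
      (swapTrans F ≫ deltaπ 1 ((tau 1).obj F)) (fun X => deltaπ_surjective 1 F _) (by
        intro X v hv
        obtain ⟨w, rfl⟩ := exists_of_deltaπ_eq_zero 1 F ((addLeft 1).obj X) v hv
        have := map_map_apply F (stab 1 ((addLeft 1).obj X)) (swap X.n) w
        rw [stab_swap] at this
        exact (congrArg ((deltaπ 1 ((tau 1).obj F)).app X) this).trans
          (deltaπ_stab 1 ((tau 1).obj F) X w))
    refine polOne_of_surjective (d := d) (G := delta 1 ((tau 1).obj F)) r (fun X w => ?_) (ih hF)
    obtain ⟨v, rfl⟩ := deltaπ_surjective 1 _ X w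
    obtain ⟨v, rfl⟩ := swapTrans_surjective F X v
    exact ⟨((tau 1).map (deltaπ 1 F)).app X v, congrArg (fun k => k.app X v) hr⟩

/-- The isomorphism `τ_1(τ_x(F)) ≅ τ_{x+1}(F)`. -/
def tauIso (x : ℕ) (F : Fct K) : (tau 1).obj ((tau x).obj F) ≅ (tau (x + 1)).obj F :=
  (Functor.associator _ _ _).symm ≪≫ Functor.isoWhiskerRight (addLeftIso x) F

theorem tauIso_hom_app (x : ℕ) (F : Fct K) (X : UBeta) :
    (tauIso x F).hom.app X = F.map ((addLeftIso x).hom.app X) := Category.id_comp _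

theorem isZero_delta_zero (F : Fct K) : IsZero (delta 0 F) := by
  refine isZero_of_apply fun X w => ?_
  obtain ⟨v, rfl⟩ := deltaπ_surjective 0 F X w
  -- Stabilisation by no strands has a section, so every vector lies in its image.
  have h : brk (X := (addLeft 0).obj X) (Y := X) (Nat.zero_add X.n).le 1 ≫ stab 0 X = 𝟙 _ := by
    refine (brk_comp _ _ _ _).trans (congrArg (brk _) ?_)
    exact (one_mul _).trans (map_one _)
  have := map_map_apply F (brk (X := (addLeft 0).obj X) (Y := X) (Nat.zero_add X.n).le 1)
    (stab 0 X) v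
  rw [h] at this
  have hv : F.map (𝟙 ((addLeft 0).obj X)) v = v := by
    rw [F.map_id]
    rfl
  rw [← hv, ← this, deltaπ_stab]

/-- Induction on `x` through the right exact sequence `δ_1 F → δ_{x+1} F → τ_1 δ_x F → 0`, the
functor `δ_0 F` being zero. -/
theorem polOne_delta {d : ℕ} {F : Fct K} (hF : polOne K d (delta 1 F)) (x : ℕ) :
    polOne K d (delta x F) := by
  induction x with
  | zero => exact polOne_of_isZero (isZero_delta_zero F)
  | succ x ih =>
    have hβ : ∀ X w, ((tauIso x F).hom ≫ deltaπ (x + 1) F).app X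
        (((tau 1).map (iTrans x F)).app X (F.map (stab 1 X) w)) = 0 := by
      intro X w
      have h := map_map_apply F (stab 1 X ≫ stab x ((addLeft 1).obj X)) ((addLeftIso x).hom.app X) w
      rw [← map_map_apply, Category.assoc, stab_stab] at h
      refine (congrArg ((deltaπ (x + 1) F).app X) ?_).trans (deltaπ_stab (x + 1) F X w)
      rw [tauIso_hom_app]
      exact h
    -- The map `δ_1 F → δ_{x+1} F` comes from `τ_1(i_x)`; it is well defined since stabilising by
    -- `1` and then by `x` is stabilising by `x + 1`.
    obtain ⟨α, hα⟩ := exists_desc (deltaπ 1 F)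
      ((tau 1).map (iTrans x F) ≫ (tauIso x F).hom ≫ deltaπ (x + 1) F) (deltaπ_surjective 1 F)
      (fun X v hv => by
        obtain ⟨w, rfl⟩ := exists_of_deltaπ_eq_zero 1 F X v hv
        exact hβ X w)
    refine polOne_of_cover α ((tauIso x F).hom ≫ deltaπ (x + 1) F) ((tau 1).map (deltaπ x F))
      (fun X => deltaπ_surjective x F _) (fun X v hv => ?_) (fun X g => ?_) hF (polOne_tau_one ih)
    · obtain ⟨w, rfl⟩ := exists_of_deltaπ_eq_zero x F ((addLeft 1).obj X) v hv
      exact ⟨(deltaπ 1 F).app X w, congrArg (fun k => k.app X w) hα⟩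
    · obtain ⟨v, rfl⟩ := deltaπ_surjective (x + 1) F X g
      obtain ⟨v, rfl⟩ := app_surjective_of_epi (tauIso x F).hom X v
      exact ⟨0, v, by rw [map_zero, zero_add, comp_app_apply]⟩

theorem polBelow_iff_polOne {d : ℕ} {F : Fct K} : polBelow K d F ↔ polOne K d F := by
  refine ⟨polOne_of_polBelow, fun h => ?_⟩
  induction d generalizing F with
  | zero => exact h
  | succ d ih => exact fun x => ih (polOne_delta h x)

theorem polOne_tau_two {d : ℕ} {F : Fct K} (hF : polOne K d F) : polOne K d ((tau 2).obj F) :=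
  polOne_of_iso (tauIso 1 F) (polOne_tau_one (polOne_tau_one hF))

/-! ### Generators and right exactness of `I_{K[G]} ⊗_{K[G]} -` -/

section AugTensor

variable {G H : Type} [Group G] [Group H] {V W U : Type u} [AddCommGroup V] [Module K V]
  [AddCommGroup W] [Module K W] [AddCommGroup U] [Module K U]

variable (K) in
/-- The element `g - 1` of the augmentation ideal. -/
noncomputable def augGen (g : G) : AugIdeal K G :=
  ⟨MonoidAlgebra.of K G g - 1, by
    change MonoidAlgebra.lift K K G 1 _ = 0
    rw [map_sub, MonoidAlgebra.lift_of, map_one, MonoidHom.one_apply, sub_self]⟩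

theorem augMap_augGen (φ : G →* H) (g : G) : augMap φ (augGen K g) = augGen K (φ g) := by
  apply Subtype.ext
  rw [augMap_coe]
  change MonoidAlgebra.mapDomainAlgHom K K φ (MonoidAlgebra.of K G g - 1) =
    MonoidAlgebra.of K H (φ g) - 1
  rw [map_sub, map_one]
  simp

theorem augGen_one : augGen K (1 : G) = 0 := by
  apply Subtype.ext
  change MonoidAlgebra.of K G 1 - 1 = 0
  rw [map_one, sub_self]

/-- The identity `gk - 1 = (g - 1)k + (k - 1)`, which reduces the augmentation ideal to generators
of the group. -/
theorem augGen_mul (g k : G) :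
    augGen K (g * k) = augMul (MonoidAlgebra.of K G k) (augGen K g) + augGen K k := by
  apply Subtype.ext
  change MonoidAlgebra.of K G (g * k) - 1 =
    (MonoidAlgebra.of K G g - 1) * MonoidAlgebra.of K G k + (MonoidAlgebra.of K G k - 1)
  rw [map_mul]
  noncomm_ring

theorem span_augGen : Submodule.span K (Set.range (augGen K (G := G))) = ⊤ := by
  -- Every `x` minus its augmentation is a combination of the elements `g - 1`; on the ideal the
  -- augmentation term vanishes.
  have key : ∀ x : MonoidAlgebra K G, ∃ i ∈ Submodule.span K (Set.range (augGen K (G := G))),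
      i.1 = x - algebraMap K _ (MonoidAlgebra.lift K K G 1 x) := by
    intro x
    induction x using MonoidAlgebra.induction_on with
    | of g =>
      refine ⟨augGen K g, Submodule.subset_span ⟨g, rfl⟩, ?_⟩
      rw [MonoidAlgebra.lift_of, MonoidHom.one_apply, map_one]
      rfl
    | add x y hx hy =>
      obtain ⟨i, hi, hi'⟩ := hx
      obtain ⟨j, hj, hj'⟩ := hy
      refine ⟨i + j, add_mem hi hj, ?_⟩
      change i.1 + j.1 = _
      rw [hi', hj', map_add, map_add]
      abel
    | smul c x hx =>
      obtain ⟨i, hi, hi'⟩ := hx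
      refine ⟨c • i, Submodule.smul_mem _ c hi, ?_⟩
      change c • i.1 = _
      rw [hi', map_smul, smul_eq_mul, map_mul, smul_sub, Algebra.smul_def c (algebraMap K _ _)]
  refine eq_top_iff.2 fun i _ => ?_
  obtain ⟨j, hj, hj'⟩ := key i.1
  have hi : MonoidAlgebra.lift K K G 1 i.1 = 0 := i.2
  rw [hi, map_zero, sub_zero] at hj'
  rwa [← Subtype.ext hj' (a1 := j) (a2 := i)]

/-- The map `v ↦ i ⊗ v`. -/
noncomputable def AugTensor.tmulLeft (ρ : Representation K G V) (i : AugIdeal K G) :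
    V →ₗ[K] AugTensor ρ := (balanced ρ).mkQ ∘ₗ TensorProduct.mk K _ _ i

theorem AugTensor.tmulLeft_apply (ρ : Representation K G V) (i : AugIdeal K G) (v : V) :
    AugTensor.tmulLeft ρ i v = AugTensor.tmul ρ i v := rfl

theorem AugTensor.add_tmul (ρ : Representation K G V) (i j : AugIdeal K G) (v : V) :
    AugTensor.tmul ρ (i + j) v = AugTensor.tmul ρ i v + AugTensor.tmul ρ j v := by
  simp only [AugTensor.tmul, TensorProduct.add_tmul, map_add]

theorem AugTensor.smul_tmul (ρ : Representation K G V) (c : K) (i : AugIdeal K G) (v : V) :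
    AugTensor.tmul ρ (c • i) v = c • AugTensor.tmul ρ i v := by
  rw [AugTensor.tmul, ← TensorProduct.smul_tmul']
  exact map_smul (balanced ρ).mkQ c (i ⊗ₜ[K] v)

theorem AugTensor.zero_tmul (ρ : Representation K G V) (v : V) : AugTensor.tmul ρ 0 v = 0 := by
  simp only [AugTensor.tmul, TensorProduct.zero_tmul, map_zero]

theorem AugTensor.augMul_tmul (ρ : Representation K G V) (i : AugIdeal K G) (g : G) (v : V) :
    AugTensor.tmul ρ (augMul (MonoidAlgebra.of K G g) i) v = AugTensor.tmul ρ i (ρ g v) := by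
  refine (Submodule.Quotient.eq _).2 (Submodule.subset_span ⟨i, MonoidAlgebra.of K G g, v, ?_⟩)
  rw [Representation.asAlgebraHom_of]

theorem AugTensor.augGen_mul_tmul (ρ : Representation K G V) (g k : G) (v : V) :
    AugTensor.tmul ρ (augGen K (g * k)) v =
      AugTensor.tmul ρ (augGen K g) (ρ k v) + AugTensor.tmul ρ (augGen K k) v := by
  rw [augGen_mul, AugTensor.add_tmul, AugTensor.augMul_tmul]

theorem AugTensor.span_tmul (ρ : Representation K G V) (S : Submodule K (AugTensor ρ))
    (h : ∀ i v, AugTensor.tmul ρ i v ∈ S) : S = ⊤ := by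
  refine eq_top_iff.2 fun t _ => ?_
  obtain ⟨t, rfl⟩ := (balanced ρ).mkQ_surjective t
  induction t using TensorProduct.induction_on with
  | zero => rw [map_zero]; exact zero_mem S
  | tmul i v => exact h i v
  | add x y hx hy => rw [map_add]; exact add_mem (hx trivial) (hy trivial)

/-- A submodule of `I_{K[G]} ⊗_{K[G]} V` is everything as soon as it contains the elements
`(g - 1) ⊗ v` where `g` runs over a generating set of `G`. -/
theorem AugTensor.eq_top_of_generators (ρ : Representation K G V) (S : Submodule K (AugTensor ρ))
    {T : Set G} (hT : Subgroup.closure T = ⊤)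
    (h : ∀ g ∈ T, ∀ v, AugTensor.tmul ρ (augGen K g) v ∈ S) : S = ⊤ := by
  have h1 : ∀ g : G, ∀ v, AugTensor.tmul ρ (augGen K g) v ∈ S := by
    intro g
    have hg : g ∈ Subgroup.closure T := hT ▸ trivial
    induction hg using Subgroup.closure_induction with
    | mem g hg => exact h g hg
    | one => intro v; rw [augGen_one, AugTensor.zero_tmul]; exact zero_mem S
    | mul g k _ _ hg hk =>
      intro v
      rw [AugTensor.augGen_mul_tmul]
      exact add_mem (hg _) (hk _)
    | inv g _ hg =>
      intro v
      -- Expanding `gg⁻¹ - 1 = 0` gives `(g⁻¹ - 1) ⊗ v = -(g - 1) ⊗ g⁻¹v`.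
      have := AugTensor.augGen_mul_tmul ρ g g⁻¹ v
      rw [mul_inv_cancel, augGen_one, AugTensor.zero_tmul] at this
      rw [eq_neg_of_add_eq_zero_right this.symm]
      exact neg_mem (hg _)
  refine AugTensor.span_tmul ρ S fun i v => ?_
  have hi : i ∈ Submodule.span K (Set.range (augGen K (G := G))) := by
    rw [span_augGen]
    trivial
  induction hi using Submodule.span_induction with
  | mem i hi => obtain ⟨g, rfl⟩ := hi; exact h1 g v
  | zero => rw [AugTensor.zero_tmul]; exact zero_mem S
  | add i j _ _ hi hj => rw [AugTensor.add_tmul]; exact add_mem hi hj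
  | smul c i _ hi => rw [AugTensor.smul_tmul]; exact S.smul_mem c hi

theorem augTensorMap_surjective (ρ : Representation K G V) (ρ' : Representation K G W)
    (L : V →ₗ[K] W) (hL : ∀ g v, L (ρ g v) = ρ' (MonoidHom.id G g) (L v))
    (h : Function.Surjective L) :
    Function.Surjective (augTensorMap ρ ρ' (MonoidHom.id G) L hL) := by
  refine LinearMap.range_eq_top.1 (AugTensor.span_tmul _ _ fun i w => ?_)
  obtain ⟨v, rfl⟩ := h w
  exact ⟨AugTensor.tmul ρ i v, by rw [augTensorMap_tmul, augMap_id]; rfl⟩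

/-- Right exactness of `I_{K[G]} ⊗_{K[G]} -`. -/
theorem augTensorMap_exact (ρ : Representation K G V) (ρ' : Representation K G W)
    (ρ'' : Representation K G U) (L : V →ₗ[K] W)
    (hL : ∀ g v, L (ρ g v) = ρ' (MonoidHom.id G g) (L v)) (M : W →ₗ[K] U)
    (hM : ∀ g v, M (ρ' g v) = ρ'' (MonoidHom.id G g) (M v)) (h : Function.Surjective M)
    (hLM : Function.Exact L M) (t : AugTensor ρ')
    (ht : augTensorMap ρ' ρ'' (MonoidHom.id G) M hM t = 0) :
    ∃ z, augTensorMap ρ ρ' (MonoidHom.id G) L hL z = t := by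
  -- Since `M` is onto and equivariant, every balancing relation over `U` lifts to one over `W`.
  -- After subtracting such a lift, right exactness of the tensor product over `K` applies.
  have hb : balanced ρ'' ≤ (balanced ρ').map (M.lTensor (AugIdeal K G)) := by
    rw [balanced, Submodule.span_le]
    rintro _ ⟨i, r, v, rfl⟩
    obtain ⟨w, rfl⟩ := h v
    refine ⟨_, Submodule.subset_span ⟨i, r, w, rfl⟩, ?_⟩
    rw [map_sub, LinearMap.lTensor_tmul, LinearMap.lTensor_tmul, asAlgebraHom_equivariant hM,
      MonoidAlgebra.mapDomainAlgHom_id]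
    rfl
  have hid : ∀ {A B : Type u} [AddCommGroup A] [Module K A] [AddCommGroup B] [Module K B]
      (N : A →ₗ[K] B), TensorProduct.map (augMap (K := K) (MonoidHom.id G)) N =
        N.lTensor (AugIdeal K G) := by
    intro A B _ _ _ _ N
    rw [augMap_id]
    rfl
  obtain ⟨t, rfl⟩ := (balanced ρ').mkQ_surjective t
  have ht' : M.lTensor (AugIdeal K G) t ∈ balanced ρ'' := by
    rw [← hid]
    exact (Submodule.Quotient.mk_eq_zero _).1 ht
  obtain ⟨b, hb', hbt⟩ := hb ht'
  obtain ⟨z, hz⟩ := (lTensor_exact (AugIdeal K G) hLM h (t - b)).1 (by rw [map_sub, hbt, sub_self])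
  refine ⟨(balanced ρ).mkQ z, ?_⟩
  change (balanced ρ').mkQ (TensorProduct.map (augMap (K := K) (MonoidHom.id G)) L z) = _
  rw [hid, hz, map_sub, sub_eq_self]
  exact (Submodule.Quotient.mk_eq_zero _).2 hb'

end AugTensor

/-! ### The splitting of `τ_1 ∘ LM` -/

section LM

variable {a : ∀ n, Braid n →* MulAut (FreeGroup (Fin n))}
  {s : ∀ n, FreeGroup (Fin n) →* Braid (1 + n)}

/-! ### Right exactness of `LM` on difference sequences. -/

theorem LM_map_surjective (hc : Coherent a s) {F G : Fct K} (η : F ⟶ G)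
    (h : ∀ X, Function.Surjective (η.app X)) (X : UBeta) :
    Function.Surjective (((LM hc).map η).app X) :=
  augTensorMap_surjective _ _ _ (lmRep_natural η X) (h _)

theorem exists_of_LM_map_deltaπ_eq_zero (hc : Coherent a s) (x : ℕ) (F : Fct K) (X : UBeta)
    (t : ((LM hc).obj ((tau x).obj F)).obj X) (ht : ((LM hc).map (deltaπ x F)).app X t = 0) :
    ∃ z, ((LM hc).map (iTrans x F)).app X z = t := by
  refine augTensorMap_exact _ _ _ _ (lmRep_natural (iTrans x F) X) _
    (lmRep_natural (deltaπ x F) X) (deltaπ_surjective x F _) (fun w => ⟨?_, ?_⟩) t ht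
  · exact exists_of_deltaπ_eq_zero x F _ w
  · rintro ⟨v, rfl⟩
    exact deltaπ_stab x F _ v

theorem isZero_LM (hc : Coherent a s) {F : Fct K} (h : IsZero F) : IsZero ((LM hc).obj F) := by
  refine isZero_of_apply fun X t => ?_
  have : (⊥ : Submodule K (AugTensor (lmRep s F X))) = ⊤ :=
    AugTensor.span_tmul _ _ fun i v => by
      rw [apply_eq_zero_of_isZero h _ v, ← AugTensor.tmulLeft_apply, map_zero]
      exact zero_mem _
  have key : ∀ t : AugTensor (lmRep s F X), t = 0 := fun t =>
    (Submodule.mem_bot K).1 (this ▸ Submodule.mem_top)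
  exact key t

/-- The first generator of `F_{1+n}`. -/
def firstGen (n : ℕ) : FreeGroup (Fin (1 + n)) := headF (Nat.le_add_right 1 n) (FreeGroup.of 0)

/-- Both reliability conditions enter here: the shift sends `g_1` to `g_{m-n+1}`, the inverse
braiding brings it back to `g_1`, and `id_1 ♮ b` fixes `g_1`. This is the naturality of `lmFirst`.
-/
theorem freeMap_firstGen (h : Reliable a s) {X Y : UBeta} (f : X ⟶ Y) :
    freeMap h.toCoherent ((addLeft 1).map f) (firstGen X.n) = firstGen Y.n := by
  induction f using brk_ind with
  | h hf b =>
  obtain ⟨n⟩ := X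
  obtain ⟨m⟩ := Y
  change n ≤ m at hf
  have h1 := h.braid_first n m hf (FreeGroup.of 0)
  have h2 := h.stabilizer m (1 + m) (Nat.le_add_left m 1) b (FreeGroup.of ⟨0, by omega⟩)
  have h3 : headF (Nat.sub_le (1 + m) m) (FreeGroup.of ⟨0, by omega⟩) = firstGen m := by
    rw [headF, FreeGroup.map.of, firstGen, headF, FreeGroup.map.of]
    rfl
  rw [h3] at h2
  change a (1 + m) (addLeftRep 1 hf b) (shiftF (Nat.add_le_add_left hf 1) (firstGen n)) = _
  rw [addLeftRep, map_mul, MulAut.mul_apply, ← map_inv]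
  refine (congrArg _ h1).trans h2

theorem closure_firstGen_shiftF (n : ℕ) :
    Subgroup.closure (insert (firstGen n)
      (Set.range (shiftF (Nat.le_add_left n 1)))) = ⊤ := by
  rw [eq_top_iff, ← FreeGroup.closure_range_of, Subgroup.closure_le]
  rintro _ ⟨i, rfl⟩
  refine Subgroup.subset_closure ?_
  rcases Nat.eq_zero_or_pos (i : ℕ) with hi | hi
  · refine Or.inl ?_
    rw [firstGen, headF, FreeGroup.map.of]
    exact congrArg FreeGroup.of (Fin.ext hi)
  · refine Or.inr ⟨FreeGroup.of ⟨i - 1, by omega⟩, ?_⟩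
    rw [shiftF, FreeGroup.map.of]
    refine congrArg FreeGroup.of (Fin.ext ?_)
    change 1 + n - n + (i - 1 : ℕ) = i
    omega

/-- The map `v ↦ (g_1 - 1) ⊗ v` from `τ_1(τ_1(F))` to `τ_1(LM(F))`. -/
noncomputable def lmFirst (h : Reliable a s) (F : Fct K) :
    (tau 1).obj ((tau 1).obj F) ⟶ (tau 1).obj ((LM h.toCoherent).obj F) where
  app X := (ModuleCat.ofHom (AugTensor.tmulLeft (lmRep s F ⟨1 + X.n⟩) (augGen K (firstGen X.n))) :
    F.obj ⟨1 + (1 + X.n)⟩ ⟶ ModuleCat.of K (AugTensor (lmRep s F ⟨1 + X.n⟩)))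
  naturality X Y f := by
    refine ModuleCat.hom_ext (LinearMap.ext fun v => ?_)
    change AugTensor.tmul (lmRep s F ⟨1 + Y.n⟩) (augGen K (firstGen Y.n))
        (lmMap F ((addLeft 1).map f) v) =
      lmMorph h.toCoherent F ((addLeft 1).map f)
        (AugTensor.tmul (lmRep s F ⟨1 + X.n⟩) (augGen K (firstGen X.n)) v)
    rw [lmMorph, augTensorMap_tmul, augMap_augGen, freeMap_firstGen h]

theorem lmRep_swap (hc : Coherent a s) (F : Fct K) (X : UBeta) (g : FreeGroup (Fin X.n))
    (v : F.obj ⟨1 + (1 + X.n)⟩) :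
    (F.map (swap X.n)).hom (lmRep s ((tau 1).obj F) X g v) =
      lmRep s F ⟨1 + X.n⟩ (shiftF (Nat.le_add_left X.n 1) g) ((F.map (swap X.n)).hom v) := by
  have h := (map_map_apply F ((addLeft 1).map (braidEnd (s X.n g))) (swap X.n) v).trans
    (congrArg (fun k => (F.map k).hom v) (braidEnd_swap hc X.n g))
  exact h.trans (map_map_apply F _ _ v).symm

theorem freeMap_stab (hc : Coherent a s) (X : UBeta) :
    freeMap hc (stab 1 X) = shiftF (Nat.le_add_left X.n 1) := by
  rw [stab, freeMap_brk, map_one]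
  rfl

/-- The map `i ⊗ v ↦ (ι_{F_1} * id_{F_n})(i) ⊗ F(b_{1,1}⁻¹ ♮ id_n)(v)` from `LM(τ_1(F))` to
`τ_1(LM(F))`. -/
noncomputable def lmShift (hc : Coherent a s) (F : Fct K) :
    (LM hc).obj ((tau 1).obj F) ⟶ (tau 1).obj ((LM hc).obj F) where
  app X := (ModuleCat.ofHom (augTensorMap (lmRep s ((tau 1).obj F) X) (lmRep s F ⟨1 + X.n⟩)
      (shiftF (Nat.le_add_left X.n 1)) (F.map (swap X.n)).hom (lmRep_swap hc F X)) :
    ModuleCat.of K (AugTensor (lmRep s ((tau 1).obj F) X)) ⟶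
      ModuleCat.of K (AugTensor (lmRep s F ⟨1 + X.n⟩)))
  naturality X Y f := by
    refine ModuleCat.hom_ext (AugTensor.hom_ext fun i v => ?_)
    change AugTensor.tmul (lmRep s F ⟨1 + Y.n⟩)
        (augMap (shiftF (Nat.le_add_left Y.n 1)) (augMap (freeMap hc f) i))
        ((swapTrans F).app Y (((tau 1).obj ((tau 1).obj F)).map f v)) =
      AugTensor.tmul (lmRep s F ⟨1 + Y.n⟩)
        (augMap (freeMap hc ((addLeft 1).map f)) (augMap (shiftF (Nat.le_add_left X.n 1)) i))
        (((tau 1).obj ((tau 1).obj F)).map f ((swapTrans F).app X v))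
    -- The shift of free groups is the map attached to stabilisation by one strand, so naturality of
    -- that stabilisation settles the ideal factor; the module factor is naturality of the swap.
    have e : augMap (K := K) (shiftF (Nat.le_add_left Y.n 1)) ∘ₗ augMap (freeMap hc f) =
        augMap (freeMap hc ((addLeft 1).map f)) ∘ₗ augMap (shiftF (Nat.le_add_left X.n 1)) := by
      rw [← freeMap_stab hc, ← freeMap_stab hc, ← augMap_comp, ← augMap_comp]
      exact congrArg _ ((freeMap_comp hc f (stab 1 Y)).symm.trans
        ((congrArg _ (stab_naturality 1 f)).trans (freeMap_comp hc _ _)))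
    rw [naturality_apply]
    exact congrArg (fun j => AugTensor.tmul _ j _) (DFunLike.congr_fun e i)

/-- On the ideal factor both sides are the shift; on the module factor the swap converts `i_1` at `1
♮ n` into `id_1 ♮ ι_1 ♮ id_n`. -/
theorem iTrans_LM (hc : Coherent a s) (F : Fct K) :
    (LM hc).map (iTrans 1 F) ≫ lmShift hc F = iTrans 1 ((LM hc).obj F) := by
  refine NatTrans.ext (funext fun X => ModuleCat.hom_ext (AugTensor.hom_ext fun i v => ?_))
  change AugTensor.tmul (lmRep s F ⟨1 + X.n⟩)
      (augMap (shiftF (Nat.le_add_left X.n 1)) (augMap (MonoidHom.id _) i))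
      (F.map (swap X.n) (F.map (stab 1 ((addLeft 1).obj X)) v)) =
    AugTensor.tmul (lmRep s F ⟨1 + X.n⟩) (augMap (freeMap hc (stab 1 X)) i)
      (F.map ((addLeft 1).map (stab 1 X)) v)
  have e := map_map_apply F (stab 1 ((addLeft 1).obj X)) (swap X.n) v
  rw [stab_swap] at e
  rw [freeMap_stab, augMap_id, ← e]
  rfl

/-- The elements `(g - 1) ⊗ v`, for `g` equal to `g_1` or in the shifted copy of `F_n`, generate the
module; invertibility of the swap puts every one of the second kind in the image of `lmShift`. -/
theorem exists_lmFirst_add_lmShift (h : Reliable a s) (F : Fct K) (X : UBeta)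
    (t : ((tau 1).obj ((LM h.toCoherent).obj F)).obj X) :
    ∃ v w, (lmFirst h F).app X v + (lmShift h.toCoherent F).app X w = t := by
  have key := AugTensor.eq_top_of_generators (lmRep s F ⟨1 + X.n⟩)
    (LinearMap.range ((lmFirst h F).app X).hom ⊔
      LinearMap.range ((lmShift h.toCoherent F).app X).hom) (closure_firstGen_shiftF X.n) (by
        rintro g (rfl | ⟨g, rfl⟩) v
        · exact Submodule.mem_sup_left ⟨v, rfl⟩
        · refine Submodule.mem_sup_right ?_
          obtain ⟨v, rfl⟩ := swapTrans_surjective F X v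
          refine ⟨AugTensor.tmul (lmRep s ((tau 1).obj F) X) (augGen K g) v, ?_⟩
          change AugTensor.tmul _ (augMap _ (augGen K g)) _ = _
          rw [augMap_augGen]
          rfl)
  have ht : ∀ t : AugTensor (lmRep s F ⟨1 + X.n⟩), t ∈
      LinearMap.range ((lmFirst h F).app X).hom ⊔
        LinearMap.range ((lmShift h.toCoherent F).app X).hom := fun t => key ▸ Submodule.mem_top
  obtain ⟨_, ⟨v, rfl⟩, _, ⟨w, rfl⟩, hvw⟩ := (Submodule.mem_sup (R := K)
    (M := ((tau 1).obj ((LM h.toCoherent).obj F)).obj X)).1 (ht t)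
  exact ⟨v, w, hvw⟩

/-! ### Induction on the degree and the main theorem. -/

theorem polOne_LM (h : Reliable a s) {d : ℕ} {F : Fct K} (hF : polOne K d F) :
    polOne K (d + 1) ((LM h.toCoherent).obj F) := by
  induction d generalizing F with
  | zero => exact polOne_of_isZero (isZero_LM _ hF)
  | succ d ih =>
    -- The goal is that `δ_1 LM(F)` is polynomial. It is covered by `τ_1 τ_1 F` and `LM(τ_1 F)`,
    -- with `LM(δ_1 F)` as the quotient of the latter. The indices match because `τ_1` preserves the
    -- bound on `F`, while `δ_1` lowers it by one and `LM` raises it again.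
    refine polOne_of_cover (d := d + 1) (lmFirst h F ≫ deltaπ 1 _)
      (lmShift h.toCoherent F ≫ deltaπ 1 _) ((LM h.toCoherent).map (deltaπ 1 F))
      (LM_map_surjective _ _ (deltaπ_surjective 1 F)) (fun X t ht => ?_) (fun X g => ?_)
      (polOne_tau_one (polOne_tau_one hF)) (ih hF)
    · obtain ⟨z, rfl⟩ := exists_of_LM_map_deltaπ_eq_zero h.toCoherent 1 F X t ht
      -- An element killed in `LM(δ_1 F)` comes from `LM(F)` through `LM(i_1 F)`; `lmShift` sends it
      -- to a stabilisation, which already vanishes in `δ_1 LM(F)`, so no correction from `τ_1 τ_1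
      -- F` is needed.
      refine ⟨0, ?_⟩
      rw [map_zero, ← comp_app_apply, ← Category.assoc, iTrans_LM]
      exact (deltaπ_stab 1 ((LM h.toCoherent).obj F) X z).symm
    · obtain ⟨t, rfl⟩ := deltaπ_surjective 1 _ X g
      obtain ⟨v, w, rfl⟩ := exists_lmFirst_add_lmShift h F X t
      exact ⟨v, w, (map_add ((deltaπ 1 ((LM h.toCoherent).obj F)).app X).hom _ _).symm⟩

end LM

end LongMoody

theorem mainTheorem5 {K : Type u} [CommRing K]
    (a : ∀ n, LongMoody.Braid n →* MulAut (FreeGroup (Fin n)))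
    (s : ∀ n, FreeGroup (Fin n) →* LongMoody.Braid (1 + n))
    (h : LongMoody.Reliable a s) (d : ℕ) :
    (∀ F : LongMoody.Fct K, LongMoody.Pol K d F →
      LongMoody.Pol K d ((LongMoody.tau 2).obj F) ∧
      LongMoody.Pol K (d + 1) ((LongMoody.LM h.toCoherent).obj F)) ∧
    ∃ R : (LongMoody.Pol K d).FullSubcategory ⥤ (LongMoody.Pol K (d + 1)).FullSubcategory,
      R ⋙ (LongMoody.Pol K (d + 1)).ι = (LongMoody.Pol K d).ι ⋙ LongMoody.LM h.toCoherent := by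
  have hLM : ∀ F : LongMoody.Fct K, LongMoody.Pol K d F →
      LongMoody.Pol K (d + 1) ((LongMoody.LM h.toCoherent).obj F) := fun F hF =>
    LongMoody.polBelow_iff_polOne.2
      (LongMoody.polOne_LM h (LongMoody.polBelow_iff_polOne.1 hF))
  refine ⟨fun F hF => ⟨?_, hLM F hF⟩, ?_⟩
  · exact LongMoody.polBelow_iff_polOne.2
      (LongMoody.polOne_tau_two (LongMoody.polBelow_iff_polOne.1 hF))
  · exact ⟨ObjectProperty.lift _ ((LongMoody.Pol K d).ι ⋙ LongMoody.LM h.toCoherent)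
      (fun F => hLM F.obj F.property), rfl⟩
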